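/- Let $a_n\ge 1$ be integers and $b_n>0$ reals ($n\ge 1$), and for each $n$ let $\xi_{1,n},\dots,\xi_{a_n,n}$ be i.i.d. real random variables with characteristic function $\theta_n$. Put $S_n=(\xi_{1,n}+\dots+\xi_{a_n,n})/b_n$, with characteristic function $\Phi_n$, let $F_n$ be the law of $\xi_{1,n}/b_n$, and set $M_n(du)=a_nu^2F_n(du)$, $\beta_n=\int\sin u\,F_n(du)$. Let $\beta\in\mathbb R$ and let $M$ be a canonical measure on $\mathbb R$, i.e. $M$ is finite on bounded intervals and $M^+(x)=\int_{(x,\infty)}u^{-2}M(du)<\infty$, $M^-(x)=\int_{(-\infty,-x)}u^{-2}M(du)<\infty$ for all $x>0$. Put $$\phi(z)=\int_{\mathbb R}\frac{1-e^{izu}+iz\sin u}{u^2}\,M(du),\qquad \psi(z)=-i\beta z+\phi(z),\qquad \Phi(z)=e^{-\psi(z)},$$ where the integrand is $z^2/2$ at $u=0$; let $\phi_n$ be defined as $\phi$ with $M_n$ in place of $M$, and let $S$ be a random variable with characteristic function $\Phi$. Write $\hat m(A)=\frac12(m(A)+m(-A))$ for the symmetrization of a measure $m$, and $$\gamma_n'=\sup_{z\in\mathbb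 R}\frac{|\operatorname{Re}\phi(z)-\operatorname{Re}\phi_n(z)|}{1+z^2}.$$ Assume that $a_n\to\infty$, that $F_n(\{|u|\ge\varepsilon\})\to0$ for all $\varepsilon>0$, that $a_n\beta_n\to\beta$, and that $M_n\to M$ properly: $M_n([x,y])\to M([x,y])$ whenever $x<y$ are not atoms of $M$, and $M_n^{\pm}(x)\to M^{\pm}(x)$ whenever $x>0$ and $\pm x$ is not an atom of $M$. Let $\delta>0$ and assume: * (A) for each $n\ge1$, $\xi_{1,n}$ has a density $g_n$; * (B) there are $\alpha\in(0,2)$ and $c>0$ with $\operatorname{Re}\psi(z)\ge c|z|^\alpha$ for all sufficiently large $|z|$; * (C) $\sup_{n\ge1,\,|z|\ge\eta}|\theta_n(z)|<1$ for every $\eta>0$; * (D) $\sup_{n\ge1}\int g_n^2(x)\,dx<\infty$; * (E) $b_n\to\infty$ and $(\ln b_n)/a_n\to0$; * (F) there are $c(\delta)>0$ and $\kappa\in(0,2)$ such that for each $n\ge1$ either (a) $a_n\int(1-\cos(zu))\hat F_n(du)\ge c(\delta)|z|^\kappa$ for all $|z|\le\delta b_n$, or (b) $\hat M\le\hat M_n$;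 * (H) both $c_n=a_n$ and $c_n=b_n$ grow polynomially: there are $s,t>0$ (depending on the sequence) with $\liminf_n c_n/n^s>0$ and $\limsup_n c_n/n^t<\infty$. Assume finally that the distributions of $S_n$ ($n\ge1$) and of $S$ are symmetric, so that $\Phi_n$ and $\Phi$ are real, and that $\Phi_n(z)\ge\Phi(z)$ for all $n\ge1$ and $|z|\le\delta b_n$. Then $S$ has a continuous density $p$, each $S_n$ ($n\ge1$) has a density $p_n$, which can be chosen continuous whenever $a_n\ge2$, and there are a constant $C>0$ and a sequence $r(n)$ with $r(n)=o(n^{-k})$ as $n\to\infty$ for every $k$, such that $$\sup_{x\in\mathbb R}|p_n(x)-p(x)|\le C\,(\gamma_n'+r(n))$$ for all $n\ge1$ with $a_n\ge2$, in particular for all sufficiently large $n$. -/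

import Mathlib

open MeasureTheory ProbabilityTheory Filter Topology Asymptotics

noncomputable section

namespace LocalLimit

/-! ### Canonical measures, characteristic exponents -/

/-- `M⁺(x) = ∫_{(x, ∞)} u⁻² M(du)`. -/
def tailPlus (M : Measure ℝ) (x : ℝ) : ENNReal :=
  ∫⁻ u in Set.Ioi x, ENNReal.ofReal (1 / u ^ 2) ∂M

/-- `M⁻(x) = ∫_{(-∞, -x)} u⁻² M(du)`. -/
def tailMinus (M : Measure ℝ) (x : ℝ) : ENNReal :=
  ∫⁻ u in Set.Iio (-x), ENNReal.ofReal (1 / u ^ 2) ∂M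

/-- Canonical measures on the line. -/
structure IsCanonical (M : Measure ℝ) : Prop where
  finite_interval : ∀ x y : ℝ, M (Set.Icc x y) < ⊤
  finite_tailPlus : ∀ x : ℝ, 0 < x → tailPlus M x < ⊤
  finite_tailMinus : ∀ x : ℝ, 0 < x → tailMinus M x < ⊤

/-- Proper convergence of canonical measures. As usual for this mode of convergence, only
intervals and tails whose end points are not atoms of the limit are tested. -/
structure ConvergesProperly (Mn : ℕ → Measure ℝ) (M : Measure ℝ) : Prop where
  interval : ∀ x y : ℝ, x < y → M {x} = 0 → M {y} = 0 →
    Tendsto (fun n => Mn n (Set.Icc x y)) atTop (𝓝 (M (Set.Icc x y)))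
  plus : ∀ x : ℝ, 0 < x → M {x} = 0 →
    Tendsto (fun n => tailPlus (Mn n) x) atTop (𝓝 (tailPlus M x))
  minus : ∀ x : ℝ, 0 < x → M {-x} = 0 →
    Tendsto (fun n => tailMinus (Mn n) x) atTop (𝓝 (tailMinus M x))

/-- The integrand `(1 - e^{izu} + i z sin u) / u²`, extended by continuity to `u = 0`, where its
value is `z² / 2`. -/
def levyKernel (z u : ℝ) : ℂ :=
  if u = 0 then ((z ^ 2 / 2 : ℝ) : ℂ)
  else (1 - Complex.exp (Complex.I * z * u) + Complex.I * z * (Real.sin u : ℂ)) / ((u ^ 2 : ℝ) : ℂ)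

/-- `φ(z) = ∫ (1 - e^{izu} + i z sin u) / u² M(du)`. -/
def phi (M : Measure ℝ) (z : ℝ) : ℂ := ∫ u, levyKernel z u ∂M

/-- The characteristic exponent `ψ(z) = -iβz + φ(z)`. -/
def psi (β : ℝ) (M : Measure ℝ) (z : ℝ) : ℂ := -(Complex.I * β * z) + phi M z

/-- The characteristic function `Φ = e^{-ψ}` of the limit. -/
def limitCharFun (β : ℝ) (M : Measure ℝ) (z : ℝ) : ℂ := Complex.exp (-psi β M z)

/-- The symmetrization `m̂(A) = (m(A) + m(-A)) / 2`. -/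
def symmetrization (m : Measure ℝ) : Measure ℝ :=
  (2⁻¹ : ENNReal) • (m + m.map (fun x => -x))

/-- The law `m` is symmetric: `m(A) = m(-A)`. -/
def IsSymmetricLaw (m : Measure ℝ) : Prop := m.map (fun x => -x) = m

/-- `f` is a probability density of the law `m`. -/
structure IsDensity (f : ℝ → ℝ) (m : Measure ℝ) : Prop where
  measurable : Measurable f
  nonneg : ∀ x, 0 ≤ f x
  eq_withDensity : m = volume.withDensity (fun x => ENNReal.ofReal (f x))

/-! ### The triangular array

`G n` is the law of `ξ_{1,n}`, `a n` the number of variables in the `n`-th row and `b n` the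
scaling. -/

/-- The law `F_n` of `X_{1,n} = ξ_{1,n} / b_n`. -/
def scaledLaw (G : ℕ → Measure ℝ) (b : ℕ → ℝ) (n : ℕ) : Measure ℝ :=
  (G n).map (fun x => x / b n)

/-- `M_n(du) = a_n u² F_n(du)`. -/
def rowMeasure (G : ℕ → Measure ℝ) (a : ℕ → ℕ) (b : ℕ → ℝ) (n : ℕ) : Measure ℝ :=
  (a n : ENNReal) • (scaledLaw G b n).withDensity (fun u => ENNReal.ofReal (u ^ 2))

/-- `β_n = ∫ sin u F_n(du)`. -/
def rowDrift (G : ℕ → Measure ℝ) (b : ℕ → ℝ) (n : ℕ) : ℝ :=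
  ∫ u, Real.sin u ∂(scaledLaw G b n)

/-- The normalized row sum `S_n = (ξ_{1,n} + ⋯ + ξ_{a_n,n}) / b_n`. -/
def rowSum {Ω : ℕ → Type*} (a : ℕ → ℕ) (b : ℕ → ℝ) (ξ : ∀ n, Fin (a n) → Ω n → ℝ) (n : ℕ)
    (ω : Ω n) : ℝ :=
  (∑ k, ξ n k ω) / b n

/-- `γ_n' = sup_z |Re φ(z) - Re φ_n(z)| / (1 + z²)`. -/
def gammaRe (M : Measure ℝ) (G : ℕ → Measure ℝ) (a : ℕ → ℕ) (b : ℕ → ℝ) (n : ℕ) : ℝ :=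
  ⨆ z : ℝ, |(phi M z).re - (phi (rowMeasure G a b n) z).re| / (1 + z ^ 2)

/-- Uniform smallness: `P(|X_{1,n}| ≥ ε) → 0` for all `ε > 0`. -/
def UniformlySmall (G : ℕ → Measure ℝ) (b : ℕ → ℝ) : Prop :=
  ∀ ε : ℝ, 0 < ε → Tendsto (fun n => scaledLaw G b n {u | ε ≤ |u|}) atTop (𝓝 0)

/-! ### The conditions -/

/-- `g n` is a density of `ξ_{1,n}`, for every `n ≥ 1`. -/
def ConditionA (G : ℕ → Measure ℝ) (g : ℕ → ℝ → ℝ) : Prop :=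
  ∀ n, 1 ≤ n → IsDensity (g n) (G n)

/-- `Re ψ(z) ≥ c |z|^α` for `|z|` large enough, for some `α ∈ (0, 2)` and `c > 0`. -/
def ConditionB (β : ℝ) (M : Measure ℝ) : Prop :=
  ∃ α c R : ℝ, 0 < α ∧ α < 2 ∧ 0 < c ∧ ∀ z : ℝ, R ≤ |z| → c * |z| ^ α ≤ (psi β M z).re

/-- `N(δ) = sup_{n ≥ 1, |z| ≥ δ} |θ_n(z)|`, with `θ_n` the characteristic function of `ξ_{1,n}`. -/
def cramerSup (G : ℕ → Measure ℝ) (δ : ℝ) : ℝ :=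
  sSup {t : ℝ | ∃ (n : ℕ) (z : ℝ), 1 ≤ n ∧ δ ≤ |z| ∧ t = ‖charFun (G n) z‖}

def ConditionC (G : ℕ → Measure ℝ) : Prop :=
  ∀ δ : ℝ, 0 < δ → cramerSup G δ < 1

def ConditionD (g : ℕ → ℝ → ℝ) : Prop :=
  (⨆ n ∈ Set.Ici (1 : ℕ), ∫⁻ x, ENNReal.ofReal (g n x ^ 2)) < ⊤

def ConditionE (a : ℕ → ℕ) (b : ℕ → ℝ) : Prop :=
  Tendsto b atTop atTop ∧ Tendsto (fun n => Real.log (b n) / (a n : ℝ)) atTop (𝓝 0)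

/-- For each `n ≥ 1` one of two alternatives holds; the constants of the first one do not
depend on `n`. The second one is the domination of the symmetrized limit measure by the
symmetrized `M_n(du) = a_n u² F_n(du)`. -/
def ConditionF (δ : ℝ) (M : Measure ℝ) (G : ℕ → Measure ℝ) (a : ℕ → ℕ) (b : ℕ → ℝ) : Prop :=
  ∃ c κ : ℝ, 0 < c ∧ 0 < κ ∧ κ < 2 ∧ ∀ n, 1 ≤ n →
    (∀ z : ℝ, |z| ≤ δ * b n →
      c * |z| ^ κ ≤ (a n : ℝ) * ∫ u, (1 - Real.cos (z * u)) ∂(symmetrization (scaledLaw G b n))) ∨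
    symmetrization M ≤ symmetrization (rowMeasure G a b n)

/-- Polynomial growth: `0 < liminf c_n / n^s` and `limsup c_n / n^t < ∞` for some `s, t > 0`. -/
def ConditionH (c : ℕ → ℝ) : Prop :=
  ∃ s t : ℝ, 0 < s ∧ 0 < t ∧
    0 < liminf (fun n : ℕ => ((c n / (n : ℝ) ^ s : ℝ) : EReal)) atTop ∧
    limsup (fun n : ℕ => ((c n / (n : ℝ) ^ t : ℝ) : EReal)) atTop < ⊤

end LocalLimit

end

namespace LocalLimit

/-! By Fourier inversion, `|p_n - p|` is at most `∫ |Φ_n - Φ|`, and this integral is split at `|z| =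
δ b_n`.

Inside, `Φ_n(z) = θ_n(z / b_n) ^ a_n` is real and at least `Φ > 0`. Continuity from `z = 0` then
forces `θ_n(z / b_n)` itself to be positive, and `t ^ k ≤ e^{-k(1-t)}` gives `Φ_n ≤ e^{-Re φ_n}`,
because `a_n (1 - Re θ_n(z / b_n)) = Re φ_n(z)`. Hence `0 ≤ Φ_n - Φ ≤ e^{-Re φ_n} - e^{-Re φ} ≤ |Re
φ - Re φ_n| e^{-Re φ_n}`. Domination is what makes this one-sided estimate sufficient: linearising
the logarithm of `Φ_n` costs no extra error term. Condition (F) bounds `e^{-Re φ_n}` by a fixed `H`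
with `(1 + z²) H` integrable, so this part is `O(γ_n')` (`norm_pow_sub_exp_neg_le`,
`ConditionF.exists_bound`).

Outside, `Φ` decays faster than every power by (B). For `Φ_n`, `a_n - 2` factors are bounded by some
`N < 1` by (C), and the remaining two are integrated through (D) and Plancherel, which gives `N ^
(a_n - 2) b_n L`. Polynomial growth of `a_n` and `b_n` makes both tails `o(n^{-k})` for every `k`.
-/

/-! ### Gaussian regularisation, the Plancherel bound and Fourier inversion. -/

/-- The Gaussian factor makes the inversion integral converge for every finite measure, and Fubini
turns it into a nonnegative smoothing of `P`. Letting `b → 0` yields both Plancherel and the sign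
and reality of the inverted density. -/
theorem integral_charFun_mul_gaussian (P : Measure ℝ) [IsFiniteMeasure P] {b : ℝ} (hb : 0 < b)
    (x : ℝ) :
    ∫ z : ℝ, Complex.exp (-(Complex.I * x * z)) * charFun P z * Complex.exp (-(b : ℂ) * z ^ 2) =
      ((√(Real.pi / b) * ∫ y, Real.exp (-(x - y) ^ 2 / (4 * b)) ∂P : ℝ) : ℂ) := by
  have hint : Integrable (Function.uncurry fun (z y : ℝ) =>
      Complex.exp (Complex.I * ((y - x : ℝ) : ℂ) * z) * Complex.exp (-(b : ℂ) * z ^ 2))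
      (volume.prod P) := by
    have h1 : Integrable (fun q : ℝ × ℝ => Real.exp (-b * q.1 ^ 2)) (volume.prod P) :=
      (integrable_exp_neg_mul_sq hb).comp_fst P
    refine h1.mono' ?_ (ae_of_all _ fun q => ?_)
    · apply Continuous.aestronglyMeasurable
      unfold Function.uncurry
      fun_prop
    · simp only [Function.uncurry, norm_mul, Complex.norm_exp]
      apply le_of_eq
      have e1 : (Complex.I * ((q.2 - x : ℝ) : ℂ) * q.1).re = 0 := by
        simp [Complex.mul_re]
      have e2 : (-(b : ℂ) * (q.1 : ℂ) ^ 2) = ((-b * q.1 ^ 2 : ℝ) : ℂ) := by push_cast; ring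
      rw [e1, e2, Complex.ofReal_re]; simp
  calc ∫ z : ℝ, Complex.exp (-(Complex.I * x * z)) * charFun P z * Complex.exp (-(b : ℂ) * z ^ 2)
      = ∫ z : ℝ, ∫ y, Complex.exp (Complex.I * ((y - x : ℝ) : ℂ) * z) *
          Complex.exp (-(b : ℂ) * z ^ 2) ∂P := by
        congr 1; ext z
        rw [integral_mul_const, charFun_apply_real, ← integral_const_mul]
        congr 2; ext y
        rw [← Complex.exp_add]; congr 1; push_cast; ring
    _ = ∫ y, (∫ z : ℝ, Complex.exp (Complex.I * ((y - x : ℝ) : ℂ) * z) *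
          Complex.exp (-(b : ℂ) * z ^ 2)) ∂P := integral_integral_swap hint
    _ = ∫ y, ((√(Real.pi / b) * Real.exp (-(x - y) ^ 2 / (4 * b)) : ℝ) : ℂ) ∂P := by
        congr 1; ext y
        rw [fourierIntegral_gaussian (by simpa using hb)]
        rw [Real.sqrt_eq_rpow, Complex.ofReal_mul, Complex.ofReal_cpow (by positivity)]
        push_cast
        congr 3; ring
    _ = _ := by rw [integral_complex_ofReal, integral_const_mul]

theorem lintegral_gaussian_sub {b : ℝ} (hb : 0 < b) (y : ℝ) :
    ∫⁻ x : ℝ, ENNReal.ofReal (√(Real.pi / b) * Real.exp (-(x - y) ^ 2 / (4 * b))) =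
      ENNReal.ofReal (2 * Real.pi) := by
  rw [lintegral_sub_right_eq_self
    (fun x : ℝ => ENNReal.ofReal (√(Real.pi / b) * Real.exp (-x ^ 2 / (4 * b)))) y]
  have h : ∀ x : ℝ, -x ^ 2 / (4 * b) = -(1 / (4 * b)) * x ^ 2 := fun x => by ring
  simp_rw [h]
  rw [← ofReal_integral_eq_lintegral_ofReal
    ((integrable_exp_neg_mul_sq (by positivity)).const_mul _) (ae_of_all _ fun x => by positivity),
    integral_const_mul, integral_gaussian, ← Real.sqrt_mul (by positivity)]
  congr 1
  rw [show Real.pi / b * (Real.pi / (1 / (4 * b))) = (2 * Real.pi) ^ 2 by field_simp; ring]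
  exact Real.sqrt_sq (by positivity)

theorem tendsto_exp_neg_inv_mul_sq (z : ℝ) :
    Tendsto (fun n : ℕ => Real.exp (-(1 / ((n : ℝ) + 1)) * z ^ 2)) atTop (𝓝 1) := by
  have h := (tendsto_one_div_add_atTop_nhds_zero_nat (𝕜 := ℝ)).neg.mul_const (z ^ 2)
  simpa [Function.comp_def] using (Real.continuous_exp.tendsto _).comp h

/-- The Plancherel inequality for a law with density `g`. -/
theorem lintegral_charFun_sq_le {G : Measure ℝ} [IsProbabilityMeasure G] {g : ℝ → ℝ}
    (hg : IsDensity g G) :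
    ∫⁻ z : ℝ, ENNReal.ofReal (‖charFun G z‖ ^ 2) ≤
      ENNReal.ofReal (2 * Real.pi) * ∫⁻ x, ENNReal.ofReal (g x ^ 2) := by
  have hgm := hg.measurable
  have key : ∀ b : ℝ, 0 < b →
      ∫⁻ z : ℝ, ENNReal.ofReal (‖charFun G z‖ ^ 2 * Real.exp (-b * z ^ 2)) ≤
      ENNReal.ofReal (2 * Real.pi) * ∫⁻ x, ENNReal.ofReal (g x ^ 2) := by
    intro b hb
    set K : ℝ → ℝ := fun y => √(Real.pi / b) * Real.exp (-y ^ 2 / (4 * b)) with hK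
    have hKm : Measurable K := by fun_prop
    have hK0 : ∀ y, 0 ≤ K y := fun y => by positivity
    have hKs : ∀ u v, K (u - v) = K (v - u) := fun u v => by
      simp only [hK]; congr 3; ring
    have hKi : ∀ v, ∫⁻ u, ENNReal.ofReal (K (u - v)) = ENNReal.ofReal (2 * Real.pi) :=
      lintegral_gaussian_sub hb
    -- The law of the difference of two independent copies has characteristic function `‖charFun G‖
    -- ^ 2`, so the regularised formula applies to it at `x = 0`.
    set Q := G.conv (G.map (fun x => -x)) with hQ
    have : IsProbabilityMeasure (G.map (fun x : ℝ => -x)) :=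
      Measure.isProbabilityMeasure_map (by fun_prop)
    have hcQ : ∀ z, charFun Q z = ((‖charFun G z‖ ^ 2 : ℝ) : ℂ) := by
      intro z
      rw [hQ, charFun_conv]
      have : charFun (G.map (fun x : ℝ => -x)) z = charFun G (-z) := by
        simpa using charFun_map_mul (μ := G) (-1) z
      rw [this, charFun_neg, Complex.mul_conj, Complex.normSq_eq_norm_sq]
    have h1 := integral_charFun_mul_gaussian Q hb 0
    have h2 : ∫ z : ℝ, ‖charFun G z‖ ^ 2 * Real.exp (-b * z ^ 2) = ∫ y, K y ∂Q := by
      have : ∫ z : ℝ, Complex.exp (-(Complex.I * (0 : ℝ) * z)) * charFun Q z *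
          Complex.exp (-(b : ℂ) * z ^ 2) =
          ∫ z : ℝ, ((‖charFun G z‖ ^ 2 * Real.exp (-b * z ^ 2) : ℝ) : ℂ) := by
        congr 1; ext z; rw [hcQ]; push_cast; simp
      rw [this, integral_complex_ofReal] at h1
      rw [Complex.ofReal_inj.mp h1, ← integral_const_mul]
      simp [hK]
    have hi : Integrable (fun z : ℝ => ‖charFun G z‖ ^ 2 * Real.exp (-b * z ^ 2)) := by
      refine (integrable_exp_neg_mul_sq hb).mono' (by fun_prop) (ae_of_all _ fun z => ?_)
      rw [Real.norm_of_nonneg (by positivity)]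
      have := norm_charFun_le_one (μ := G) z
      exact mul_le_of_le_one_left (by positivity) (pow_le_one₀ (by positivity) this)
    have hKQ : Integrable K Q := by
      refine (integrable_const (√(Real.pi / b))).mono' (by fun_prop) (ae_of_all _ fun z => ?_)
      rw [Real.norm_of_nonneg (hK0 z)]
      refine mul_le_of_le_one_right (by positivity) (Real.exp_le_one_iff.mpr ?_)
      exact div_nonpos_of_nonpos_of_nonneg (by nlinarith [sq_nonneg z]) (by positivity)
    rw [← ofReal_integral_eq_lintegral_ofReal hi (ae_of_all _ fun z => by positivity), h2,
      ofReal_integral_eq_lintegral_ofReal hKQ (ae_of_all _ hK0), hQ,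
      Measure.lintegral_conv (by fun_prop)]
    have h3 : ∀ x, ∫⁻ y, ENNReal.ofReal (K (x + y)) ∂(G.map (fun x => -x)) =
        ∫⁻ y, ENNReal.ofReal (K (x - y)) ∂G := fun x => by
      rw [lintegral_map (by fun_prop) (by fun_prop)]
      rfl
    simp_rw [h3]
    have hw : ∀ f : ℝ → ENNReal, Measurable f →
        ∫⁻ y, f y ∂G = ∫⁻ y, ENNReal.ofReal (g y) * f y := fun f hf => by
      rw [hg.eq_withDensity, lintegral_withDensity_eq_lintegral_mul _ (by fun_prop) hf]
      rfl
    have h4 : ∀ x, ∫⁻ y, ENNReal.ofReal (K (x - y)) ∂G =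
        ∫⁻ y, ENNReal.ofReal (g y) * ENNReal.ofReal (K (x - y)) := fun x =>
      hw _ (by fun_prop)
    simp_rw [h4]
    rw [hw _ (by fun_prop)]
    calc ∫⁻ x, ENNReal.ofReal (g x) * ∫⁻ y, ENNReal.ofReal (g y) * ENNReal.ofReal (K (x - y))
        = ∫⁻ x, ∫⁻ y, ENNReal.ofReal (g x) * (ENNReal.ofReal (g y) * ENNReal.ofReal (K (x - y))) := by
          congr 1; ext x; rw [lintegral_const_mul _ (by fun_prop)]
      -- `g x * g y ≤ (g x ^ 2 + g y ^ 2) / 2`. In each summand the free variable then meets only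
      -- the kernel, whose total mass is `2π`.
      _ ≤ ∫⁻ x, ∫⁻ y, (ENNReal.ofReal (g x ^ 2 / 2) * ENNReal.ofReal (K (y - x)) +
            ENNReal.ofReal (g y ^ 2 / 2) * ENNReal.ofReal (K (x - y))) := by
          refine lintegral_mono fun x => lintegral_mono fun y => ?_
          simp only
          rw [hKs y x, ← mul_assoc, ← add_mul, ← ENNReal.ofReal_mul (hg.nonneg x),
            ← ENNReal.ofReal_add (by positivity) (by positivity)]
          gcongr
          nlinarith [sq_nonneg (g x - g y)]
      _ = (∫⁻ x, ∫⁻ y, ENNReal.ofReal (g x ^ 2 / 2) * ENNReal.ofReal (K (y - x))) +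
            ∫⁻ x, ∫⁻ y, ENNReal.ofReal (g y ^ 2 / 2) * ENNReal.ofReal (K (x - y)) := by
          rw [← lintegral_add_left (by fun_prop)]
          congr 1; ext x
          rw [lintegral_add_left (by fun_prop)]
      _ = (∫⁻ x, ENNReal.ofReal (g x ^ 2 / 2) * ENNReal.ofReal (2 * Real.pi)) +
            ∫⁻ y, ENNReal.ofReal (g y ^ 2 / 2) * ENNReal.ofReal (2 * Real.pi) := by
          congr 1
          · congr 1; ext x
            rw [lintegral_const_mul _ (by fun_prop), hKi]
          · rw [lintegral_lintegral_swap (by fun_prop)]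
            congr 1; ext x
            rw [lintegral_const_mul _ (by fun_prop), hKi]
      _ = ∫⁻ x, ENNReal.ofReal (g x ^ 2) * ENNReal.ofReal (2 * Real.pi) := by
          rw [← lintegral_add_left (by fun_prop)]
          congr 1; ext x
          rw [← add_mul, ← ENNReal.ofReal_add (by positivity) (by positivity)]
          congr 2; ring
      _ ≤ _ := by rw [lintegral_mul_const _ (by fun_prop), mul_comm]
  -- Fatou's lemma removes the Gaussian factor along `b = 1 / (n + 1)`.
  calc ∫⁻ z : ℝ, ENNReal.ofReal (‖charFun G z‖ ^ 2)
      = ∫⁻ z : ℝ, liminf (fun n : ℕ => ENNReal.ofReal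
          (‖charFun G z‖ ^ 2 * Real.exp (-(1 / ((n : ℝ) + 1)) * z ^ 2))) atTop := by
        congr 1; ext z
        refine (Tendsto.liminf_eq ?_).symm
        refine ENNReal.tendsto_ofReal ?_
        simpa using (tendsto_exp_neg_inv_mul_sq z).const_mul (‖charFun G z‖ ^ 2)
    _ ≤ liminf (fun n : ℕ => ∫⁻ z : ℝ, ENNReal.ofReal
          (‖charFun G z‖ ^ 2 * Real.exp (-(1 / ((n : ℝ) + 1)) * z ^ 2))) atTop :=
        lintegral_liminf_le fun n => by fun_prop
    _ ≤ liminf (fun _ : ℕ => ENNReal.ofReal (2 * Real.pi) *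
          ∫⁻ x, ENNReal.ofReal (g x ^ 2)) atTop :=
        liminf_le_liminf (Eventually.of_forall fun n => key _ (by positivity))
    _ = _ := liminf_const _

/-- The candidate density `x ↦ (2π)⁻¹ ∫ e^{-izx} φ_P(z) dz` of a law with integrable
characteristic function. -/
noncomputable def invDensity (P : Measure ℝ) (x : ℝ) : ℝ :=
  (2 * Real.pi)⁻¹ * (∫ z : ℝ, Complex.exp (-(Complex.I * x * z)) * charFun P z).re

theorem norm_exp_neg_I_mul (x z : ℝ) : ‖Complex.exp (-(Complex.I * x * z))‖ = 1 := by
  rw [Complex.norm_exp]; simp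

theorem integrable_exp_mul {f : ℝ → ℂ} (hf : Integrable f) (x : ℝ) :
    Integrable (fun z : ℝ => Complex.exp (-(Complex.I * x * z)) * f z) := by
  refine hf.norm.mono' ?_ (ae_of_all _ fun z => ?_)
  · exact (by fun_prop : Continuous fun z : ℝ =>
      Complex.exp (-(Complex.I * x * z))).aestronglyMeasurable.mul hf.1
  · rw [norm_mul, norm_exp_neg_I_mul, one_mul]

theorem continuous_integral_exp_mul {f : ℝ → ℂ} (hf : Integrable f) :
    Continuous fun x : ℝ => ∫ z : ℝ, Complex.exp (-(Complex.I * x * z)) * f z := by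
  refine continuous_of_dominated (fun x => (integrable_exp_mul hf x).1) (bound := fun z => ‖f z‖)
    (fun x => ae_of_all _ fun z => ?_) hf.norm (ae_of_all _ fun z => by fun_prop)
  rw [norm_mul, norm_exp_neg_I_mul, one_mul]

theorem continuous_invDensity {P : Measure ℝ} (h : Integrable (charFun P)) :
    Continuous (invDensity P) :=
  continuous_const.mul (Complex.continuous_re.comp (continuous_integral_exp_mul h))

theorem tendsto_gaussian_smoothing {P : Measure ℝ} [IsFiniteMeasure P]
    (h : Integrable (charFun P)) (x : ℝ) :
    Tendsto (fun n : ℕ => ((√(Real.pi / (1 / ((n : ℝ) + 1))) *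
      ∫ y, Real.exp (-(x - y) ^ 2 / (4 * (1 / ((n : ℝ) + 1)))) ∂P : ℝ) : ℂ)) atTop
      (𝓝 (∫ z : ℝ, Complex.exp (-(Complex.I * x * z)) * charFun P z)) := by
  have h1 : ∀ n : ℕ, _ := fun n =>
    integral_charFun_mul_gaussian P (b := 1 / ((n : ℝ) + 1)) (by positivity) x
  simp_rw [← h1]
  have e : ∀ (n : ℕ) (z : ℝ), Complex.exp (-((1 / ((n : ℝ) + 1) : ℝ) : ℂ) * z ^ 2) =
      ((Real.exp (-(1 / ((n : ℝ) + 1)) * z ^ 2) : ℝ) : ℂ) := fun n z => by push_cast; ring_nf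
  simp_rw [e]
  have hi := integrable_exp_mul h x
  refine tendsto_integral_of_dominated_convergence (fun z => ‖charFun P z‖) (fun n => ?_) h.norm
    (fun n => ae_of_all _ fun z => ?_) (ae_of_all _ fun z => ?_)
  · exact hi.1.mul (by fun_prop : Continuous fun z : ℝ =>
      ((Real.exp (-(1 / ((n : ℝ) + 1)) * z ^ 2) : ℝ) : ℂ)).aestronglyMeasurable
  · rw [norm_mul, norm_mul, norm_exp_neg_I_mul, one_mul, Complex.norm_real,
      Real.norm_of_nonneg (by positivity)]
    refine mul_le_of_le_one_right (by positivity) (Real.exp_le_one_iff.mpr ?_)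
    have : 0 ≤ 1 / ((n : ℝ) + 1) * z ^ 2 := by positivity
    linarith
  · have := (Complex.continuous_ofReal.tendsto _).comp (tendsto_exp_neg_inv_mul_sq z)
    simpa using this.const_mul (Complex.exp (-(Complex.I * x * z)) * charFun P z)

theorem invDensity_nonneg {P : Measure ℝ} [IsFiniteMeasure P] (h : Integrable (charFun P))
    (x : ℝ) : 0 ≤ invDensity P x := by
  refine mul_nonneg (by positivity) ?_
  refine ge_of_tendsto ((Complex.continuous_re.tendsto _).comp (tendsto_gaussian_smoothing h x))
    (Eventually.of_forall fun n => ?_)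
  simp only [Function.comp, Complex.ofReal_re]
  positivity

theorem ofReal_invDensity {P : Measure ℝ} [IsFiniteMeasure P] (h : Integrable (charFun P))
    (x : ℝ) : (invDensity P x : ℂ) =
      (2 * Real.pi)⁻¹ * ∫ z : ℝ, Complex.exp (-(Complex.I * x * z)) * charFun P z := by
  have him : (∫ z : ℝ, Complex.exp (-(Complex.I * x * z)) * charFun P z).im = 0 := by
    refine tendsto_nhds_unique
      ((Complex.continuous_im.tendsto _).comp (tendsto_gaussian_smoothing h x)) ?_
    simp [Function.comp_def]
  unfold invDensity
  apply Complex.ext <;> simp [him, Complex.mul_re, Complex.mul_im]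

/-- Each Gaussian regularisation of the density has total mass `P univ`; Fatou carries this bound to
the limit. -/
theorem integrable_invDensity {P : Measure ℝ} [IsFiniteMeasure P] (h : Integrable (charFun P)) :
    Integrable (invDensity P) := by
  refine ⟨(continuous_invDensity h).aestronglyMeasurable, ?_⟩
  rw [hasFiniteIntegral_iff_ofReal (ae_of_all _ (invDensity_nonneg h))]
  set q : ℕ → ℝ → ℝ := fun n x => √(Real.pi / (1 / ((n : ℝ) + 1))) *
      ∫ y, Real.exp (-(x - y) ^ 2 / (4 * (1 / ((n : ℝ) + 1)))) ∂P with hq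
  have hqi : ∀ n, ∀ x, ENNReal.ofReal (q n x) = ∫⁻ y, ENNReal.ofReal
      (√(Real.pi / (1 / ((n : ℝ) + 1))) *
        Real.exp (-(x - y) ^ 2 / (4 * (1 / ((n : ℝ) + 1))))) ∂P := by
    intro n x
    simp only [hq]
    rw [← integral_const_mul, ofReal_integral_eq_lintegral_ofReal _
      (ae_of_all _ fun z => by positivity)]
    refine (integrable_const (√(Real.pi / (1 / ((n : ℝ) + 1))))).mono' (by fun_prop)
      (ae_of_all _ fun z => ?_)
    rw [Real.norm_of_nonneg (by positivity)]
    refine mul_le_of_le_one_right (by positivity) (Real.exp_le_one_iff.mpr ?_)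
    exact div_nonpos_of_nonpos_of_nonneg (by nlinarith [sq_nonneg (x - z)]) (by positivity)
  have hqm : ∀ n, Measurable fun x => ENNReal.ofReal ((2 * Real.pi)⁻¹ * q n x) := by
    intro n
    simp_rw [fun x => ENNReal.ofReal_mul (p := (2 * Real.pi)⁻¹) (q := q n x) (by positivity), hqi]
    refine Measurable.const_mul (Measurable.lintegral_prod_right' (ν := P)
      (f := fun w : ℝ × ℝ => ENNReal.ofReal (√(Real.pi / (1 / ((n : ℝ) + 1))) *
        Real.exp (-(w.1 - w.2) ^ 2 / (4 * (1 / ((n : ℝ) + 1)))))) (by fun_prop)) _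
  have hqint : ∀ n, ∫⁻ x, ENNReal.ofReal ((2 * Real.pi)⁻¹ * q n x) = P Set.univ := by
    intro n
    simp_rw [fun x => ENNReal.ofReal_mul (p := (2 * Real.pi)⁻¹) (q := q n x) (by positivity), hqi]
    rw [lintegral_const_mul' _ _ ENNReal.ofReal_ne_top, lintegral_lintegral_swap (by fun_prop)]
    simp_rw [lintegral_gaussian_sub (b := 1 / ((n : ℝ) + 1)) (by positivity)]
    rw [lintegral_const, ← mul_assoc, ← ENNReal.ofReal_mul (by positivity),
      inv_mul_cancel₀ (by positivity), ENNReal.ofReal_one, one_mul]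
  calc ∫⁻ x, ENNReal.ofReal (invDensity P x)
      = ∫⁻ x, liminf (fun n => ENNReal.ofReal ((2 * Real.pi)⁻¹ * q n x)) atTop := by
        congr 1; ext x
        refine (Tendsto.liminf_eq (ENNReal.tendsto_ofReal ?_)).symm
        have := (Complex.continuous_re.tendsto _).comp (tendsto_gaussian_smoothing h x)
        exact this.const_mul _
    _ ≤ liminf (fun n => ∫⁻ x, ENNReal.ofReal ((2 * Real.pi)⁻¹ * q n x)) atTop :=
        lintegral_liminf_le hqm
    _ = P Set.univ := by simp_rw [hqint]; exact liminf_const _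
    _ < ⊤ := measure_lt_top _ _

/-- Inversion shows that the measure with density `invDensity P` has characteristic function
`charFun P`, and characteristic functions determine finite measures. -/
theorem isDensity_invDensity {P : Measure ℝ} [IsFiniteMeasure P] (h : Integrable (charFun P)) :
    IsDensity (invDensity P) P := by
  refine ⟨(continuous_invDensity h).measurable, invDensity_nonneg h, ?_⟩
  have hint := integrable_invDensity h
  -- The factor `2π` matches the Fourier convention with kernel `e^{-2πixw}`.
  set f : ℝ → ℂ := fun w => charFun P (2 * Real.pi * w) with hf
  have hfc : Continuous f := continuous_charFun.comp (by fun_prop)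
  have hfi : Integrable f := h.comp_mul_left' (by positivity)
  have hF : FourierTransform.fourier f = fun x => (invDensity P x : ℂ) := by
    ext x
    rw [Real.fourier_eq', ofReal_invDensity h]
    have := Measure.integral_comp_mul_left
      (fun z : ℝ => Complex.exp (-(Complex.I * x * z)) * charFun P z) (2 * Real.pi)
    rw [abs_of_pos (by positivity)] at this
    rw [← Complex.real_smul, ← this]
    congr 1; ext w
    simp only [hf, smul_eq_mul]
    congr 2
    simp; ring
  have hinv := hfc.fourierInv_fourier_eq hfi (by rw [hF]; exact hint.ofReal)
  have : IsFiniteMeasure (volume.withDensity fun x => ENNReal.ofReal (invDensity P x)) :=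
    isFiniteMeasure_withDensity_ofReal hint.2
  refine Measure.ext_of_charFun (funext fun z => ?_)
  have hz := congrFun hinv (z / (2 * Real.pi))
  rw [Real.fourierInv_eq', hF] at hz
  simp only [hf] at hz
  rw [mul_div_cancel₀ _ (by positivity)] at hz
  rw [← hz, charFun_apply_real, integral_withDensity_eq_integral_toReal_smul
    (by have := (continuous_invDensity h).measurable; fun_prop) (by simp)]
  congr 1; ext x
  rw [ENNReal.toReal_ofReal (invDensity_nonneg h x), Complex.real_smul, smul_eq_mul, mul_comm]
  congr 2
  have : (Real.pi : ℂ) ≠ 0 := by exact_mod_cast Real.pi_ne_zero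
  simp
  field_simp

theorem abs_invDensity_sub_le {P Q : Measure ℝ} (hP : Integrable (charFun P))
    (hQ : Integrable (charFun Q)) (x : ℝ) :
    |invDensity P x - invDensity Q x| ≤ ∫ z : ℝ, ‖charFun P z - charFun Q z‖ := by
  unfold invDensity
  rw [← mul_sub, ← Complex.sub_re, ← integral_sub (integrable_exp_mul hP x)
    (integrable_exp_mul hQ x), abs_mul, abs_of_pos (by positivity)]
  have h1 : (2 * Real.pi)⁻¹ ≤ 1 := inv_le_one_of_one_le₀ (by linarith [Real.pi_gt_three])
  refine (mul_le_of_le_one_left (abs_nonneg _) h1).trans ((Complex.abs_re_le_norm _).trans ?_)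
  refine (norm_integral_le_integral_norm _).trans (le_of_eq ?_)
  congr 1; ext z
  rw [← mul_sub, norm_mul, norm_exp_neg_I_mul, one_mul]

/-! ### The Lévy kernel and the real part of the exponent. -/

theorem exp_I_mul_mul (z u : ℝ) :
    Complex.exp (Complex.I * z * u) = ⟨Real.cos (z * u), Real.sin (z * u)⟩ := by
  have : Complex.I * z * u = ((z * u : ℝ) : ℂ) * Complex.I := by push_cast; ring
  rw [this]
  exact Complex.ext (Complex.exp_ofReal_mul_I_re _) (Complex.exp_ofReal_mul_I_im _)

theorem levyKernel_re (z u : ℝ) :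
    (levyKernel z u).re = if u = 0 then z ^ 2 / 2 else (1 - Real.cos (z * u)) / u ^ 2 := by
  unfold levyKernel
  split_ifs with h
  · simp only [Complex.ofReal_re]
  · rw [exp_I_mul_mul, Complex.div_ofReal_re]
    simp [Complex.mul_re, Complex.mul_im, -Complex.ofReal_sin]

theorem levyKernel_im (z u : ℝ) :
    (levyKernel z u).im = if u = 0 then 0 else (z * Real.sin u - Real.sin (z * u)) / u ^ 2 := by
  unfold levyKernel
  split_ifs with h
  · simp only [Complex.ofReal_im]
  · rw [exp_I_mul_mul, Complex.div_ofReal_im]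
    simp [Complex.mul_re, Complex.mul_im, -Complex.ofReal_sin]
    ring

theorem sq_mul_levyKernel_re (z u : ℝ) : u ^ 2 * (levyKernel z u).re = 1 - Real.cos (z * u) := by
  rw [levyKernel_re]
  split_ifs with h
  · simp [h]
  · field_simp

theorem levyKernel_re_nonneg (z u : ℝ) : 0 ≤ (levyKernel z u).re := by
  rw [levyKernel_re]
  split_ifs with h
  · positivity
  · exact div_nonneg (by linarith [Real.cos_le_one (z * u)]) (by positivity)

theorem levyKernel_re_neg (z u : ℝ) : (levyKernel z (-u)).re = (levyKernel z u).re := by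
  simp [levyKernel_re]

theorem measurable_levyKernel (z : ℝ) : Measurable (levyKernel z) := by
  unfold levyKernel
  exact Measurable.ite (measurableSet_singleton 0) measurable_const (by fun_prop)

theorem levyKernel_re_le_sq (z u : ℝ) : (levyKernel z u).re ≤ z ^ 2 / 2 := by
  rw [levyKernel_re]
  split_ifs with h
  · exact le_rfl
  · rw [div_le_iff₀ (by positivity)]
    have := Real.one_sub_sq_div_two_le_cos (x := z * u)
    nlinarith

theorem abs_sub_sin_le (x : ℝ) : |x - Real.sin x| ≤ 2 * x ^ 2 := by
  have h1 : |Real.sin x| ≤ |x| := Real.abs_sin_le_abs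
  rcases le_or_gt |x| 1 with h | h
  · have h2 := Real.sin_bound h
    have h3 : |x| ^ 5 ≤ x ^ 2 := by
      rw [← sq_abs x]; exact pow_le_pow_of_le_one (abs_nonneg _) h (by norm_num)
    have h4 : |x ^ 3 / 6| ≤ x ^ 2 := by
      have : |x| ^ 3 ≤ x ^ 2 := by
        rw [← sq_abs x]; exact pow_le_pow_of_le_one (abs_nonneg _) h (by norm_num)
      rw [abs_div, abs_pow, abs_of_pos (by norm_num : (0 : ℝ) < 6)]
      have := sq_nonneg x
      linarith
    have h5 : x - Real.sin x = x ^ 3 / 6 - (Real.sin x - (x - x ^ 3 / 6)) := by ring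
    rw [h5]
    refine (abs_sub _ _).trans ?_
    have := sq_nonneg x
    linarith
  · refine (abs_sub _ _).trans ?_
    have : |x| ≤ x ^ 2 := by rw [← sq_abs x]; nlinarith
    linarith

theorem abs_levyKernel_im_le (z u : ℝ) : |(levyKernel z u).im| ≤ 2 * |z| + 2 * z ^ 2 := by
  rw [levyKernel_im]
  split_ifs with h
  · simp; positivity
  · rw [abs_div, abs_of_pos (by positivity : 0 < u ^ 2), div_le_iff₀ (by positivity)]
    have h1 := abs_sub_sin_le u
    have h2 := abs_sub_sin_le (z * u)
    have h3 : z * Real.sin u - Real.sin (z * u) =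
      (z * u - Real.sin (z * u)) - z * (u - Real.sin u) := by ring
    rw [h3]
    refine (abs_sub _ _).trans ?_
    rw [abs_mul z]
    have := mul_le_mul_of_nonneg_left h1 (abs_nonneg z)
    nlinarith

theorem sq_mul_abs_levyKernel_im_le (z u : ℝ) : u ^ 2 * |(levyKernel z u).im| ≤ |z| + 1 := by
  rw [levyKernel_im]
  split_ifs with h
  · simp; positivity
  · rw [abs_div, abs_of_pos (by positivity : 0 < u ^ 2), mul_div_cancel₀ _ (by positivity)]
    refine (abs_sub _ _).trans ?_
    rw [abs_mul]
    have := mul_le_of_le_one_right (abs_nonneg z) (Real.abs_sin_le_one u)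
    linarith [Real.abs_sin_le_one (z * u)]

theorem levyKernel_re_le (z u : ℝ) :
    (levyKernel z u).re ≤ 2 * (1 + z ^ 2) * (1 + u ^ 2)⁻¹ := by
  rw [← div_eq_mul_inv, le_div_iff₀ (by positivity)]
  have h1 := levyKernel_re_le_sq z u
  have h2 := sq_mul_levyKernel_re z u
  have h3 := Real.neg_one_le_cos (z * u)
  nlinarith [sq_nonneg z]

/-- The weight `(1 + u ^ 2)⁻¹` combines boundedness near `0` with `u⁻²` decay at infinity. Both
canonical measures and the `M_n` integrate it, so it serves as the common integrability criterion.
-/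
theorem norm_levyKernel_le (z u : ℝ) :
    ‖levyKernel z u‖ ≤ (2 * (1 + z ^ 2) + (3 * |z| + 2 * z ^ 2 + 1)) * (1 + u ^ 2)⁻¹ := by
  refine (Complex.norm_le_abs_re_add_abs_im _).trans ?_
  rw [abs_of_nonneg (levyKernel_re_nonneg z u), add_mul]
  refine add_le_add (levyKernel_re_le z u) ?_
  rw [← div_eq_mul_inv, le_div_iff₀ (by positivity)]
  linarith [abs_levyKernel_im_le z u, sq_mul_abs_levyKernel_im_le z u]

theorem IsCanonical.integrable_weight {M : Measure ℝ} (hM : IsCanonical M) :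
    Integrable (fun u : ℝ => (1 + u ^ 2)⁻¹) M := by
  refine ⟨by fun_prop, ?_⟩
  rw [hasFiniteIntegral_iff_ofReal (ae_of_all _ fun u => by positivity)]
  have hcover : (Set.univ : Set ℝ) ⊆ Set.Icc (-1) 1 ∪ (Set.Ioi 1 ∪ Set.Iio (-1)) := by
    intro u _
    rcases le_or_gt u 1 with h | h
    · rcases le_or_gt (-1) u with h' | h'
      · exact Or.inl ⟨h', h⟩
      · exact Or.inr (Or.inr h')
    · exact Or.inr (Or.inl h)
  have htail : ∀ s : Set ℝ, MeasurableSet s → (∀ u ∈ s, u ≠ 0) →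
      ∫⁻ u in s, ENNReal.ofReal (1 + u ^ 2)⁻¹ ∂M ≤ ∫⁻ u in s, ENNReal.ofReal (1 / u ^ 2) ∂M := by
    intro s hs h
    refine setLIntegral_mono' hs fun u hu => ENNReal.ofReal_le_ofReal ?_
    have := h u hu
    rw [one_div]
    exact inv_anti₀ (by positivity) (by linarith)
  rw [← setLIntegral_univ]
  refine (lintegral_mono_set hcover).trans_lt ?_
  refine (lintegral_union_le _ _ _).trans_lt (ENNReal.add_lt_top.2 ⟨?_, ?_⟩)
  · calc ∫⁻ u in Set.Icc (-1) 1, ENNReal.ofReal (1 + u ^ 2)⁻¹ ∂M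
        ≤ ∫⁻ _ in Set.Icc (-1) 1, 1 ∂M := by
          refine lintegral_mono fun u => ?_
          rw [ENNReal.ofReal_le_one]
          exact inv_le_one_of_one_le₀ (by nlinarith [sq_nonneg u])
      _ = M (Set.Icc (-1) 1) := by simp
      _ < ⊤ := hM.finite_interval _ _
  · refine (lintegral_union_le _ _ _).trans_lt (ENNReal.add_lt_top.2 ⟨?_, ?_⟩)
    · refine (htail _ measurableSet_Ioi fun u hu => ?_).trans_lt (hM.finite_tailPlus 1 one_pos)
      exact (zero_lt_one.trans hu).ne'
    · refine (htail _ measurableSet_Iio fun u hu => ?_).trans_lt (hM.finite_tailMinus 1 one_pos)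
      have : u < -1 := hu
      exact (by linarith : u < 0).ne

theorem integrable_levyKernel {m : Measure ℝ} (hm : Integrable (fun u : ℝ => (1 + u ^ 2)⁻¹) m)
    (z : ℝ) : Integrable (levyKernel z) m :=
  (hm.const_mul _).mono' (measurable_levyKernel z).aestronglyMeasurable
    (ae_of_all _ (norm_levyKernel_le z))

theorem phi_re {m : Measure ℝ} (hm : Integrable (fun u : ℝ => (1 + u ^ 2)⁻¹) m) (z : ℝ) :
    (phi m z).re = ∫ u, (levyKernel z u).re ∂m :=
  (integral_re (integrable_levyKernel hm z)).symm

theorem ofReal_phi_re {m : Measure ℝ} (hm : Integrable (fun u : ℝ => (1 + u ^ 2)⁻¹) m) (z : ℝ) :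
    ENNReal.ofReal (phi m z).re = ∫⁻ u, ENNReal.ofReal (levyKernel z u).re ∂m := by
  rw [phi_re hm]
  exact ofReal_integral_eq_lintegral_ofReal (integrable_levyKernel hm z).re
    (ae_of_all _ (levyKernel_re_nonneg z))

theorem phi_re_nonneg {m : Measure ℝ} (hm : Integrable (fun u : ℝ => (1 + u ^ 2)⁻¹) m) (z : ℝ) :
    0 ≤ (phi m z).re := by
  rw [phi_re hm]; exact integral_nonneg (levyKernel_re_nonneg z)

theorem phi_re_le {m : Measure ℝ} (hm : Integrable (fun u : ℝ => (1 + u ^ 2)⁻¹) m) (z : ℝ) :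
    (phi m z).re ≤ 2 * (∫ u, (1 + u ^ 2)⁻¹ ∂m) * (1 + z ^ 2) := by
  rw [phi_re hm, mul_assoc, mul_comm (∫ u, (1 + u ^ 2)⁻¹ ∂m), ← mul_assoc, ← integral_const_mul]
  exact integral_mono (integrable_levyKernel hm z).re (hm.const_mul _) (levyKernel_re_le z)

/-- A real supremum over an unbounded family takes the default value `0`, so boundedness must be
shown; it follows from the growth of both exponents being at most of order `1 + z ^ 2`. -/
theorem abs_phi_re_sub_le {M : Measure ℝ} {G : ℕ → Measure ℝ} {a : ℕ → ℕ} {b : ℕ → ℝ} {n : ℕ}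
    (hM : Integrable (fun u : ℝ => (1 + u ^ 2)⁻¹) M)
    (hn : Integrable (fun u : ℝ => (1 + u ^ 2)⁻¹) (rowMeasure G a b n)) (z : ℝ) :
    |(phi M z).re - (phi (rowMeasure G a b n) z).re| ≤ gammaRe M G a b n * (1 + z ^ 2) := by
  rw [← div_le_iff₀ (by positivity)]
  refine le_ciSup (f := fun z : ℝ =>
    |(phi M z).re - (phi (rowMeasure G a b n) z).re| / (1 + z ^ 2)) ?_ z
  refine ⟨2 * (∫ u, (1 + u ^ 2)⁻¹ ∂M) + 2 * (∫ u, (1 + u ^ 2)⁻¹ ∂(rowMeasure G a b n)), ?_⟩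
  rintro _ ⟨z, rfl⟩
  simp only
  rw [div_le_iff₀ (by positivity), add_mul]
  refine (abs_sub _ _).trans ?_
  rw [abs_of_nonneg (phi_re_nonneg hM z), abs_of_nonneg (phi_re_nonneg hn z)]
  exact add_le_add (phi_re_le hM z) (phi_re_le hn z)

theorem gammaRe_nonneg (M : Measure ℝ) (G : ℕ → Measure ℝ) (a : ℕ → ℕ) (b : ℕ → ℝ) (n : ℕ) :
    0 ≤ gammaRe M G a b n :=
  Real.iSup_nonneg fun z => by positivity

theorem lintegral_symmetrization (m : Measure ℝ) {f : ℝ → ENNReal} (hf : Measurable f)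
    (heven : ∀ u, f (-u) = f u) : ∫⁻ u, f u ∂(symmetrization m) = ∫⁻ u, f u ∂m := by
  unfold symmetrization
  rw [lintegral_smul_measure, lintegral_add_measure, lintegral_map hf (by fun_prop)]
  simp_rw [heven]
  rw [← two_mul, smul_eq_mul, ← mul_assoc, ENNReal.inv_mul_cancel (by simp) (by simp), one_mul]

theorem integral_symmetrization (m : Measure ℝ) {f : ℝ → ℝ} (hf : Measurable f)
    (hf0 : ∀ u, 0 ≤ f u) (heven : ∀ u, f (-u) = f u) :
    ∫ u, f u ∂(symmetrization m) = ∫ u, f u ∂m := by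
  rw [integral_eq_lintegral_of_nonneg_ae (ae_of_all _ hf0) hf.aestronglyMeasurable,
    integral_eq_lintegral_of_nonneg_ae (ae_of_all _ hf0) hf.aestronglyMeasurable,
    lintegral_symmetrization m (by fun_prop) (fun u => by rw [heven])]

/-- The real part of the kernel is even and nonnegative, so its integral sees only the
symmetrization and is monotone in it. -/
theorem phi_re_le_of_symmetrization_le {m m' : Measure ℝ}
    (hm : Integrable (fun u : ℝ => (1 + u ^ 2)⁻¹) m)
    (hm' : Integrable (fun u : ℝ => (1 + u ^ 2)⁻¹) m')
    (h : symmetrization m ≤ symmetrization m') (z : ℝ) : (phi m z).re ≤ (phi m' z).re := by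
  rw [← ENNReal.ofReal_le_ofReal_iff (phi_re_nonneg hm' z), ofReal_phi_re hm, ofReal_phi_re hm']
  have hme : Measurable fun u => ENNReal.ofReal (levyKernel z u).re :=
    (Complex.measurable_re.comp (measurable_levyKernel z)).ennreal_ofReal
  have hev : ∀ u, ENNReal.ofReal (levyKernel z (-u)).re = ENNReal.ofReal (levyKernel z u).re :=
    fun u => by rw [levyKernel_re_neg]
  rw [← lintegral_symmetrization m hme hev, ← lintegral_symmetrization m' hme hev]
  exact lintegral_mono' h le_rfl

section Row

variable {G : ℕ → Measure ℝ} {a : ℕ → ℕ} {b : ℕ → ℝ} {n : ℕ}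

theorem integrable_weight_rowMeasure [IsProbabilityMeasure (scaledLaw G b n)] :
    Integrable (fun u : ℝ => (1 + u ^ 2)⁻¹) (rowMeasure G a b n) := by
  refine Integrable.smul_measure ?_ (ENNReal.natCast_ne_top _)
  rw [integrable_withDensity_iff (by fun_prop) (by simp)]
  refine (integrable_const (1 : ℝ)).mono' (by fun_prop) (ae_of_all _ fun u => ?_)
  rw [ENNReal.toReal_ofReal (by positivity), Real.norm_of_nonneg (by positivity),
    inv_mul_le_one₀ (by positivity)]
  linarith

/-- The density `u ^ 2` of `M_n` cancels the denominator of the kernel. -/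
theorem phi_rowMeasure_re [IsProbabilityMeasure (scaledLaw G b n)] (z : ℝ) :
    (phi (rowMeasure G a b n) z).re =
      (a n : ℝ) * ∫ u, (1 - Real.cos (z * u)) ∂(scaledLaw G b n) := by
  rw [phi_re integrable_weight_rowMeasure, rowMeasure, integral_smul_measure,
    integral_withDensity_eq_integral_toReal_smul (by fun_prop) (by simp)]
  simp only [ENNReal.toReal_natCast, smul_eq_mul]
  congr 2; ext u
  rw [ENNReal.toReal_ofReal (by positivity), sq_mul_levyKernel_re]

theorem integral_one_sub_cos {F : Measure ℝ} [IsProbabilityMeasure F] (z : ℝ) :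
    ∫ u, (1 - Real.cos (z * u)) ∂F = 1 - (charFun F z).re := by
  have hi : Integrable (fun u : ℝ => Complex.exp (z * u * Complex.I)) F := by
    refine (integrable_const (1 : ℝ)).mono' (by fun_prop) (ae_of_all _ fun u => ?_)
    rw [← Complex.ofReal_mul, Complex.norm_exp_ofReal_mul_I]
  have hc : ∀ u : ℝ, Real.cos (z * u) = (Complex.exp (z * u * Complex.I)).re := fun u => by
    rw [← Complex.ofReal_mul, Complex.exp_ofReal_mul_I_re]
  have : (charFun F z).re = ∫ u, (Complex.exp (z * u * Complex.I)).re ∂F := by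
    rw [charFun_apply_real]; exact (integral_re hi).symm
  simp_rw [this, hc]
  exact (integral_sub (integrable_const _) hi.re).trans (by simp)

end Row

/-! ### Positivity of characteristic functions and exponential inequalities. -/

/-- A continuous function on an interval around `0` whose `k`-th power is positive and which takes
the value `1` at `0` is positive. -/
theorem eq_norm_of_pow_eq_norm {f : ℝ → ℂ} (hf : Continuous f) (hf0 : f 0 = 1) {k : ℕ}
    (hk : k ≠ 0) {T : ℝ} (hpos : ∀ z, |z| ≤ T → f z ^ k = ((‖f z‖ ^ k : ℝ) : ℂ) ∧ f z ≠ 0)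
    {z : ℝ} (hz : |z| ≤ T) : f z = ‖f z‖ := by
  have hT : 0 ≤ T := (abs_nonneg z).trans hz
  set g : ℝ → ℂ := fun z => f z / ‖f z‖ with hg
  have hgc : ContinuousOn g (Set.Icc (-T) T) := by
    refine hf.continuousOn.div (Complex.continuous_ofReal.comp hf.norm).continuousOn ?_
    intro y hy
    simpa using (hpos y (abs_le.mpr hy)).2
  have hfin : ((Polynomial.nthRoots k (1 : ℂ)).toFinset : Set ℂ).Finite := Finset.finite_toSet _
  have hmaps : Set.MapsTo g (Set.Icc (-T) T) (Polynomial.nthRoots k (1 : ℂ)).toFinset := by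
    intro y hy
    obtain ⟨h1, h2⟩ := hpos y (abs_le.mpr hy)
    simp only [Finset.mem_coe, Multiset.mem_toFinset]
    rw [Polynomial.mem_nthRoots (Nat.pos_of_ne_zero hk), hg]
    simp only
    rw [div_pow, h1]
    push_cast
    exact div_self (pow_ne_zero _ (by simpa using h2))
  have hd : IsDiscrete ((Polynomial.nthRoots k (1 : ℂ)).toFinset : Set ℂ) := hfin.isDiscrete
  have := isPreconnected_Icc.constant_of_mapsTo hd hgc hmaps (abs_le.mp hz)
    (⟨by linarith, hT⟩ : (0 : ℝ) ∈ Set.Icc (-T) T)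
  simp only [hg, hf0, norm_one, Complex.ofReal_one, div_one] at this
  rwa [div_eq_one_iff_eq (by simpa using (hpos z hz).2)] at this

theorem IsSymmetricLaw.charFun_im {m : Measure ℝ} (h : IsSymmetricLaw m) (z : ℝ) :
    (charFun m z).im = 0 := by
  have h1 : charFun (m.map fun x : ℝ => -x) z = charFun m (-z) := by
    simpa using charFun_map_mul (μ := m) (-1) z
  rw [show m.map (fun x : ℝ => -x) = m from h, charFun_neg] at h1
  exact Complex.conj_eq_iff_im.mp h1.symm

/-- A continuous zero-free real function with value `1` at `0` is positive. -/
theorem pos_of_ne_zero_of_continuous {f : ℝ → ℝ} (hf : Continuous f) (h0 : f 0 = 1)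
    (hne : ∀ z, f z ≠ 0) (z : ℝ) : 0 < f z := by
  by_contra hz
  obtain ⟨y, hy⟩ := mem_range_of_exists_le_of_exists_ge hf ⟨z, not_lt.mp hz⟩
    ⟨0, by rw [h0]; exact zero_le_one⟩
  exact hne y hy

theorem pow_le_exp_neg_mul_one_sub {t : ℝ} (ht : 0 ≤ t) (k : ℕ) :
    t ^ k ≤ Real.exp (-(k * (1 - t))) := by
  have h : t ≤ Real.exp (t - 1) := by linarith [Real.add_one_le_exp (t - 1)]
  calc t ^ k ≤ Real.exp (t - 1) ^ k := pow_le_pow_left₀ ht h k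
    _ = _ := by rw [← Real.exp_nat_mul]; congr 1; ring

/-- The tangent-line bound is taken at `x`, so that with `x = Re φ_n` only `e^{-Re φ_n}` needs an
integrable majorant. -/
theorem exp_neg_sub_exp_neg_le {x y : ℝ} :
    Real.exp (-x) - Real.exp (-y) ≤ |y - x| * Real.exp (-x) := by
  have h := Real.add_one_le_exp (x - y)
  have h2 : Real.exp (-y) = Real.exp (-x) * Real.exp (x - y) := by
    rw [← Real.exp_add]; congr 1; ring
  rw [h2]
  nlinarith [Real.exp_pos (-x), le_abs_self (y - x)]

/-! ### Tail integrals and decay beyond every power of `n`. -/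

theorem integrable_comp_abs {f : ℝ → ℝ} (hf : IntegrableOn f (Set.Ioi 0)) :
    Integrable fun x => f |x| := by
  have hpos : IntegrableOn (fun x => f |x|) (Set.Ioi 0) :=
    hf.congr_fun (fun x hx => by rw [abs_of_pos hx]) measurableSet_Ioi
  have hneg : IntegrableOn (fun x => f |x|) (Set.Iic 0) := by
    rw [← Measure.map_neg_eq_self (volume : Measure ℝ)]
    have m : MeasurableEmbedding fun x : ℝ => -x := (Homeomorph.neg ℝ).measurableEmbedding
    rw [m.integrableOn_map_iff]
    simp_rw [Function.comp_def, abs_neg, Set.neg_preimage, Set.neg_Iic, neg_zero]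
    exact Iff.mpr integrableOn_Ici_iff_integrableOn_Ioi hpos
  rw [← integrableOn_univ, ← Set.Iic_union_Ioi (a := (0 : ℝ))]
  exact hneg.union hpos

theorem integrable_abs_pow_mul_exp_neg {c α : ℝ} (hc : 0 < c) (hα : 0 < α) (m : ℕ) :
    Integrable fun z : ℝ => |z| ^ m * Real.exp (-c * |z| ^ α) := by
  have h := integrableOn_rpow_mul_exp_neg_mul_rpow (s := m) (p := α) (b := c)
    (by linarith [(Nat.cast_nonneg m : (0 : ℝ) ≤ m)]) hα hc
  have h2 : IntegrableOn (fun z : ℝ => z ^ m * Real.exp (-c * z ^ α)) (Set.Ioi 0) := by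
    simpa using h
  exact integrable_comp_abs h2

theorem exists_le_mul_exp_neg {f : ℝ → ℝ} (hf : ∀ z, f z ≤ 1) {c α R : ℝ} (hc : 0 < c)
    (hα : 0 < α) (h : ∀ z, R ≤ |z| → f z ≤ Real.exp (-c * |z| ^ α)) :
    ∃ K : ℝ, 0 ≤ K ∧ ∀ z, f z ≤ K * Real.exp (-c * |z| ^ α) := by
  have hR : 1 ≤ Real.exp (c * |R| ^ α) := Real.one_le_exp (by positivity)
  -- This constant compensates the exponential on `|z| < R`, where only `f z ≤ 1` is known.
  refine ⟨Real.exp (c * |R| ^ α), by positivity, fun z => ?_⟩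
  rcases le_or_gt R |z| with hz | hz
  · exact (h z hz).trans (le_mul_of_one_le_left (by positivity) hR)
  · refine (hf z).trans ?_
    rw [← Real.exp_add]
    refine Real.one_le_exp ?_
    have := Real.rpow_le_rpow (abs_nonneg z) (hz.le.trans (le_abs_self R)) hα.le
    nlinarith

/-- Markov's inequality for the `m`-th absolute moment; with `T = δ b_n`, every moment gives another
power of `b_n`. -/
theorem setIntegral_tail_le {f : ℝ → ℝ} (hf0 : ∀ z, 0 ≤ f z) (hfi : Integrable f) {m : ℕ}
    (hfm : Integrable fun z : ℝ => |z| ^ m * f z) {T : ℝ} (hT : 0 < T) :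
    ∫ z in {z : ℝ | |z| ≤ T}ᶜ, f z ≤ (T ^ m)⁻¹ * ∫ z : ℝ, |z| ^ m * f z := by
  have hs : MeasurableSet {z : ℝ | |z| ≤ T}ᶜ :=
    (measurableSet_le (by fun_prop) measurable_const).compl
  rw [← integral_const_mul]
  refine (setIntegral_mono_on hfi.integrableOn (hfm.const_mul _).integrableOn hs
    fun z hz => ?_).trans (setIntegral_le_integral (hfm.const_mul _) (ae_of_all _ fun z => ?_))
  · have hz' : T ≤ |z| := by
      exact le_of_not_ge fun h => hz h
    rw [← mul_assoc]
    refine le_mul_of_one_le_left (hf0 z) ?_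
    rw [inv_mul_eq_div, one_le_div (by positivity)]
    exact pow_le_pow_left₀ hT.le hz' m
  · have := hf0 z
    simp only [Pi.zero_apply]
    positivity

theorem ConditionH.exists_lower {c : ℕ → ℝ} (h : ConditionH c) :
    ∃ s ε : ℝ, 0 < s ∧ 0 < ε ∧ ∀ᶠ n : ℕ in atTop, ε * (n : ℝ) ^ s ≤ c n := by
  obtain ⟨s, t, hs, ht, h1, h2⟩ := h
  obtain ⟨ε, h3, h4⟩ := EReal.lt_iff_exists_real_btwn.mp h1
  refine ⟨s, ε, hs, by exact_mod_cast h3, ?_⟩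
  filter_upwards [eventually_lt_of_lt_liminf h4, eventually_gt_atTop 0] with n hn hn0
  have hn' : (0 : ℝ) < n := by exact_mod_cast hn0
  have := EReal.coe_lt_coe_iff.mp hn
  rw [lt_div_iff₀ (by positivity)] at this
  exact this.le

theorem ConditionH.exists_upper {c : ℕ → ℝ} (h : ConditionH c) :
    ∃ t K : ℝ, 0 < t ∧ ∀ᶠ n : ℕ in atTop, c n ≤ K * (n : ℝ) ^ t := by
  obtain ⟨s, t, hs, ht, h1, h2⟩ := h
  obtain ⟨K, h3, h4⟩ := EReal.lt_iff_exists_real_btwn.mp h2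
  refine ⟨t, K, ht, ?_⟩
  filter_upwards [eventually_lt_of_limsup_lt h3, eventually_gt_atTop 0] with n hn hn0
  have hn' : (0 : ℝ) < n := by exact_mod_cast hn0
  have := EReal.coe_lt_coe_iff.mp hn
  rw [div_lt_iff₀ (by positivity)] at this
  exact this.le

theorem isLittleO_inv_pow_of_le_rpow {r : ℕ → ℝ} {K q : ℝ} {k : ℕ} (hq : k < q)
    (h : ∀ᶠ n : ℕ in atTop, |r n| ≤ K * (n : ℝ) ^ (-q)) :
    r =o[atTop] (fun n : ℕ => ((n : ℝ) ^ k)⁻¹) := by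
  have h1 : r =O[atTop] fun n : ℕ => (n : ℝ) ^ (-q) := by
    refine IsBigO.of_bound K ?_
    filter_upwards [h] with n hn
    rwa [Real.norm_eq_abs, Real.norm_of_nonneg (by positivity)]
  refine h1.trans_isLittleO ?_
  rw [isLittleO_iff_tendsto' (by
    filter_upwards [eventually_gt_atTop 0] with n hn h0
    have : (0 : ℝ) < n := by exact_mod_cast hn
    exact absurd h0 (by positivity))]
  refine ((tendsto_rpow_neg_atTop (sub_pos.mpr hq)).comp tendsto_natCast_atTop_atTop).congr' ?_
  filter_upwards [eventually_gt_atTop 0] with n hn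
  have hn' : (0 : ℝ) < n := by exact_mod_cast hn
  simp only [Function.comp]
  rw [div_inv_eq_mul, ← Real.rpow_natCast, ← Real.rpow_add hn']
  congr 1; ring

/-- Negative powers of a sequence of polynomial growth, up to a polynomial factor, are negligible
at every order. -/
theorem isLittleO_inv_pow_of_forall_pow_mul_le {r x y : ℕ → ℝ} {s ε t K : ℝ} (hs : 0 < s)
    (hε : 0 < ε) (hx : ∀ᶠ n : ℕ in atTop, ε * (n : ℝ) ^ s ≤ x n)
    (hy : ∀ᶠ n : ℕ in atTop, y n ≤ K * (n : ℝ) ^ t)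
    (hr : ∀ m : ℕ, ∃ L : ℝ, 0 ≤ L ∧ ∀ᶠ n : ℕ in atTop, |r n| ≤ L * y n * (x n ^ m)⁻¹) (k : ℕ) :
    r =o[atTop] (fun n : ℕ => ((n : ℝ) ^ k)⁻¹) := by
  -- This choice makes `m * s - t > k`: the power of `x n` outweighs both the factor `n ^ t` and the
  -- target order.
  obtain ⟨m, hm⟩ := exists_nat_gt ((k + t) / s)
  rw [div_lt_iff₀ hs] at hm
  obtain ⟨L, hL, hr⟩ := hr m
  refine isLittleO_inv_pow_of_le_rpow (K := L * |K| * (ε ^ m)⁻¹) (q := m * s - t)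
    (by linarith) ?_
  filter_upwards [hx, hy, hr, eventually_gt_atTop 0] with n h1 h2 h3 hn
  have hn' : (0 : ℝ) < n := by exact_mod_cast hn
  have h4 : (x n ^ m)⁻¹ ≤ ((ε * (n : ℝ) ^ s) ^ m)⁻¹ :=
    inv_anti₀ (by positivity) (pow_le_pow_left₀ (by positivity) h1 m)
  have h5 : 0 ≤ (x n ^ m)⁻¹ := inv_nonneg.mpr (pow_nonneg (le_trans (by positivity) h1) m)
  have h6 : y n ≤ |K| * (n : ℝ) ^ t :=
    h2.trans (mul_le_mul_of_nonneg_right (le_abs_self K) (by positivity))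
  calc |r n| ≤ L * y n * (x n ^ m)⁻¹ := h3
    _ ≤ L * (|K| * (n : ℝ) ^ t) * (x n ^ m)⁻¹ := by gcongr
    _ ≤ L * (|K| * (n : ℝ) ^ t) * ((ε * (n : ℝ) ^ s) ^ m)⁻¹ := by gcongr
    _ = L * |K| * (ε ^ m)⁻¹ * (n : ℝ) ^ (-(m * s - t)) := by
      rw [mul_pow, mul_inv, ← Real.rpow_mul_natCast hn'.le, ← Real.rpow_neg hn'.le,
        show -(m * s - t) = t + -(s * m) by ring, Real.rpow_add hn']
      ring

theorem exists_pow_mul_pow_sub_two_le {N : ℝ} (hN0 : 0 < N) (hN1 : N < 1) (m : ℕ) :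
    ∃ L : ℝ, 0 ≤ L ∧ ∀ j : ℕ, 2 ≤ j → N ^ (j - 2) ≤ L * ((j : ℝ) ^ m)⁻¹ := by
  have h := tendsto_pow_const_mul_const_pow_of_lt_one m hN0.le hN1
  obtain ⟨B, hB⟩ := h.bddAbove_range
  have hB0 : 0 ≤ B := le_trans (by positivity) (hB ⟨0, rfl⟩)
  refine ⟨B * (N ^ 2)⁻¹, by positivity, fun j hj => ?_⟩
  have h1 : (j : ℝ) ^ m * N ^ j ≤ B := hB ⟨j, rfl⟩
  have hj' : (0 : ℝ) < j := by exact_mod_cast (by omega : 0 < j)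
  rw [← div_eq_mul_inv, le_div_iff₀ (by positivity), ← div_eq_mul_inv, le_div_iff₀ (by positivity)]
  calc N ^ (j - 2) * (j : ℝ) ^ m * N ^ 2 = (j : ℝ) ^ m * (N ^ (j - 2) * N ^ 2) := by ring
    _ = (j : ℝ) ^ m * N ^ j := by rw [← pow_add, Nat.sub_add_cancel hj]
    _ ≤ B := h1

/-! ### Row sums: characteristic functions, densities and tails. -/

theorem charFun_map_div (m : Measure ℝ) (b z : ℝ) :
    charFun (m.map fun x => x / b) z = charFun m (z / b) := by
  have h := charFun_map_mul (μ := m) b⁻¹ z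
  simp_rw [inv_mul_eq_div] at h
  exact h

theorem charFun_map_sum_div {Ω : Type*} [MeasurableSpace Ω] {μ : Measure Ω} {k : ℕ}
    {ξ : Fin k → Ω → ℝ} {G : Measure ℝ} (hindep : iIndepFun ξ μ)
    (hlaw : ∀ i, HasLaw (ξ i) G μ) (b z : ℝ) :
    charFun (μ.map fun ω => (∑ i, ξ i ω) / b) z = charFun G (z / b) ^ k := by
  have hae : ∀ i, AEMeasurable (ξ i) μ := fun i => (hlaw i).aemeasurable
  have h : μ.map (fun ω => (∑ i, ξ i ω) / b) =
      (μ.map fun ω => ∑ i, ξ i ω).map fun x => x / b := by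
    rw [AEMeasurable.map_map_of_aemeasurable (by fun_prop)
      (Finset.aemeasurable_fun_sum _ fun i _ => hae i)]
    rfl
  rw [h, charFun_map_div, hindep.charFun_map_fun_sum_eq_prod hae]
  simp [fun i => (hlaw i).map_eq]

theorem lintegral_comp_mul_left {c : ℝ} (hc : c ≠ 0) {f : ℝ → ENNReal} (hf : Measurable f) :
    ∫⁻ x, f (c * x) = ENNReal.ofReal |c⁻¹| * ∫⁻ x, f x := by
  rw [← lintegral_map (g := fun x => c * x) hf (by fun_prop), Real.map_volume_mul_left hc,
    lintegral_smul_measure, smul_eq_mul]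

theorem IsDensity.map_div {f : ℝ → ℝ} {m : Measure ℝ} (h : IsDensity f m) {b : ℝ} (hb : 0 < b) :
    IsDensity (fun x => b * f (b * x)) (m.map fun x => x / b) := by
  have hf := h.measurable
  refine ⟨by fun_prop, fun x => mul_nonneg hb.le (h.nonneg _), ?_⟩
  ext s hs
  have hpre : MeasurableSet ((fun x : ℝ => x / b) ⁻¹' s) := hs.preimage (by fun_prop)
  rw [Measure.map_apply (by fun_prop) hs, h.eq_withDensity, withDensity_apply _ hpre,
    withDensity_apply _ hs, ← lintegral_indicator hpre, ← lintegral_indicator hs]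
  have hF : Measurable (((fun x : ℝ => x / b) ⁻¹' s).indicator fun x => ENNReal.ofReal (f x)) :=
    Measurable.indicator (by fun_prop) hpre
  have key := lintegral_comp_mul_left hb.ne' hF
  rw [abs_of_pos (by positivity)] at key
  have h1 : ENNReal.ofReal b * ENNReal.ofReal b⁻¹ = 1 := by
    rw [← ENNReal.ofReal_mul hb.le, mul_inv_cancel₀ hb.ne', ENNReal.ofReal_one]
  rw [← one_mul (∫⁻ x, ((fun x : ℝ => x / b) ⁻¹' s).indicator _ x), ← h1, mul_assoc, ← key,
    ← lintegral_const_mul' _ _ ENNReal.ofReal_ne_top]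
  congr 1; ext x
  have hx : b * x / b = x := mul_div_cancel_left₀ x hb.ne'
  by_cases hxs : x ∈ s
  · rw [Set.indicator_of_mem (by simpa [hx] using hxs), Set.indicator_of_mem hxs,
      ENNReal.ofReal_mul hb.le]
  · rw [Set.indicator_of_notMem (by simpa [hx] using hxs), Set.indicator_of_notMem hxs, mul_zero]

theorem integrable_charFun_div_sq {G : Measure ℝ}
    (h2 : Integrable fun z => ‖charFun G z‖ ^ 2) {b : ℝ}
    (hb : 0 < b) : Integrable fun z => ‖charFun G (z / b)‖ ^ 2 :=
  h2.comp_div hb.ne'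

section Tail

variable {G : Measure ℝ} [IsProbabilityMeasure G]

theorem integrable_charFun_div_pow (h2 : Integrable fun z => ‖charFun G z‖ ^ 2) {b : ℝ}
    (hb : 0 < b) {k : ℕ} (hk : 2 ≤ k) : Integrable fun z => charFun G (z / b) ^ k := by
  refine (integrable_charFun_div_sq h2 hb).mono' ?_ (ae_of_all _ fun z => ?_)
  · have hc : Continuous (charFun G) := continuous_charFun
    exact ((hc.comp (continuous_id.div_const b)).pow k).aestronglyMeasurable
  · rw [norm_pow]
    exact pow_le_pow_of_le_one (norm_nonneg _) (norm_charFun_le_one _) hk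

/-- Beyond `δ * b` the argument `z / b` has modulus at least `δ`, so `k - 2` factors are bounded by
`N`. The other two supply integrability, and rescaling them produces the factor `b`. -/
theorem setIntegral_charFun_div_pow_le (h2 : Integrable fun z => ‖charFun G z‖ ^ 2) {b δ N : ℝ}
    (hb : 0 < b) (hN0 : 0 ≤ N) (hN : ∀ z, δ ≤ |z| → ‖charFun G z‖ ≤ N) {k : ℕ} (hk : 2 ≤ k) :
    ∫ z in {z : ℝ | |z| ≤ δ * b}ᶜ, ‖charFun G (z / b) ^ k‖ ≤
      N ^ (k - 2) * (b * ∫ z, ‖charFun G z‖ ^ 2) := by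
  have hs : MeasurableSet {z : ℝ | |z| ≤ δ * b}ᶜ :=
    (measurableSet_le (by fun_prop) measurable_const).compl
  have hi := (integrable_charFun_div_sq h2 hb).const_mul (N ^ (k - 2))
  have hcv : ∫ z, ‖charFun G (z / b)‖ ^ 2 = b * ∫ z, ‖charFun G z‖ ^ 2 := by
    rw [Measure.integral_comp_div (fun z => ‖charFun G z‖ ^ 2) b, abs_of_pos hb, smul_eq_mul]
  rw [← hcv, ← integral_const_mul]
  refine (setIntegral_mono_on (integrable_charFun_div_pow h2 hb hk).norm.integrableOn
    hi.integrableOn hs fun z hz => ?_).trans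
    (setIntegral_le_integral hi (ae_of_all _ fun z => ?_))
  · have hz' : δ ≤ |z / b| := by
      rw [abs_div, abs_of_pos hb, le_div_iff₀ hb]
      exact le_of_not_ge fun h => hz h
    rw [norm_pow, show ‖charFun G (z / b)‖ ^ k =
      ‖charFun G (z / b)‖ ^ (k - 2) * ‖charFun G (z / b)‖ ^ 2 by
        rw [← pow_add, Nat.sub_add_cancel hk]]
    exact mul_le_mul_of_nonneg_right (pow_le_pow_left₀ (norm_nonneg _) (hN _ hz') _)
      (by positivity)
  · simp only [Pi.zero_apply]
    positivity

theorem integrable_charFun_sq {g : ℝ → ℝ} (hg : IsDensity g G) {B : ENNReal} (hB : B < ⊤)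
    (h : ∫⁻ x, ENNReal.ofReal (g x ^ 2) ≤ B) :
    Integrable (fun z => ‖charFun G z‖ ^ 2) ∧
      ∫ z, ‖charFun G z‖ ^ 2 ≤ (ENNReal.ofReal (2 * Real.pi) * B).toReal := by
  have h1 : ∫⁻ z : ℝ, ENNReal.ofReal (‖charFun G z‖ ^ 2) ≤ ENNReal.ofReal (2 * Real.pi) * B :=
    (lintegral_charFun_sq_le hg).trans (by gcongr)
  have h2 : ENNReal.ofReal (2 * Real.pi) * B < ⊤ := ENNReal.mul_lt_top ENNReal.ofReal_lt_top hB
  refine ⟨⟨by fun_prop, ?_⟩, ?_⟩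
  · rw [hasFiniteIntegral_iff_ofReal (ae_of_all _ fun z => by positivity)]
    exact h1.trans_lt h2
  · rw [integral_eq_lintegral_of_nonneg_ae (ae_of_all _ fun z => by positivity) (by fun_prop)]
    exact ENNReal.toReal_mono h2.ne h1

end Tail

theorem ConditionC.exists_lt_one {G : ℕ → Measure ℝ} (h : ConditionC G)
    (hG : ∀ n, 1 ≤ n → IsProbabilityMeasure (G n)) {δ : ℝ} (hδ : 0 < δ) :
    ∃ N : ℝ, 0 < N ∧ N < 1 ∧ ∀ n, 1 ≤ n → ∀ z, δ ≤ |z| → ‖charFun (G n) z‖ ≤ N := by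
  -- The maximum with `1 / 2` keeps `N` strictly positive, as the later division by `N ^ 2`
  -- requires.
  refine ⟨max (cramerSup G δ) (1 / 2), by positivity, max_lt (h δ hδ) (by norm_num),
    fun n hn z hz => le_max_of_le_left (le_csSup ⟨1, ?_⟩ ⟨n, z, hn, hz, rfl⟩)⟩
  rintro _ ⟨n, z, hn, -, rfl⟩
  have := hG n hn
  exact norm_charFun_le_one z

/-! ### The limit law and the comparison of characteristic functions. -/

section Limit

variable {β : ℝ} {M P : Measure ℝ}

theorem psi_re (β : ℝ) (M : Measure ℝ) (z : ℝ) : (psi β M z).re = (phi M z).re := by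
  simp [psi, Complex.mul_re, Complex.mul_im]

theorem norm_limitCharFun (β : ℝ) (M : Measure ℝ) (z : ℝ) :
    ‖limitCharFun β M z‖ = Real.exp (-(phi M z).re) := by
  rw [limitCharFun, Complex.norm_exp, Complex.neg_re, psi_re]

/-- Symmetry makes the function real, and an exponential has no zeros. Being continuous with value
`1` at `0`, it is positive and equals its modulus, in which the imaginary part of `ψ` disappears. -/
theorem charFun_eq_exp_neg_phi_re [IsProbabilityMeasure P]
    (hP : ∀ z : ℝ, charFun P z = limitCharFun β M z) (hsymm : IsSymmetricLaw P) (z : ℝ) :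
    charFun P z = ((Real.exp (-(phi M z).re) : ℝ) : ℂ) := by
  have him := hsymm.charFun_im
  have hreal : ∀ z, charFun P z = ((charFun P z).re : ℂ) := fun z =>
    Complex.ext (by simp) (by simp [him])
  have hpos : 0 < (charFun P z).re := by
    refine pos_of_ne_zero_of_continuous (f := fun z => (charFun P z).re)
      (Complex.continuous_re.comp continuous_charFun) (by simp) (fun z h => ?_) z
    have h0 : charFun P z = 0 := by rw [hreal z]; exact_mod_cast h
    rw [hP] at h0
    exact Complex.exp_ne_zero _ h0
  have hn : ‖charFun P z‖ = (charFun P z).re := by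
    conv_lhs => rw [hreal z]
    rw [Complex.norm_real, Real.norm_of_nonneg hpos.le]
  rw [hreal z, ← hn, hP z, norm_limitCharFun]

end Limit

/-- The comparison of `Φ_n = f ^ k` and `Φ = e^{-h}` where `0 < Φ ≤ Φ_n`. -/
theorem norm_pow_sub_exp_neg_le {f : ℝ → ℂ} (hf : Continuous f) (hf0 : f 0 = 1) {k : ℕ}
    (hk : k ≠ 0) {h : ℝ → ℝ} {T : ℝ} (him : ∀ z, (f z ^ k).im = 0)
    (hdom : ∀ z, |z| ≤ T → Real.exp (-h z) ≤ (f z ^ k).re) {z : ℝ} (hz : |z| ≤ T) :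
    ‖f z ^ k - ((Real.exp (-h z) : ℝ) : ℂ)‖ ≤
      |h z - k * (1 - (f z).re)| * Real.exp (-(k * (1 - (f z).re))) := by
  have hreal : ∀ z, f z ^ k = ((f z ^ k).re : ℂ) := fun z =>
    Complex.ext (by simp) (by simp [him])
  have hpow : ∀ z, |z| ≤ T → f z ^ k = ((‖f z‖ ^ k : ℝ) : ℂ) ∧ f z ≠ 0 := by
    intro z hz
    have hp : 0 < (f z ^ k).re := (Real.exp_pos _).trans_le (hdom z hz)
    refine ⟨?_, fun h0 => ?_⟩
    · rw [← norm_pow]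
      conv_rhs => rw [hreal z]
      rw [Complex.norm_real, Real.norm_of_nonneg hp.le]
      exact hreal z
    · rw [h0, zero_pow hk] at hp
      simp at hp
  have hfz := eq_norm_of_pow_eq_norm hf hf0 hk hpow hz
  have hre : (f z).re = ‖f z‖ := by
    conv_lhs => rw [hfz]
    exact Complex.ofReal_re _
  have hd := hdom z hz
  rw [(hpow z hz).1, Complex.ofReal_re] at hd
  rw [(hpow z hz).1, ← Complex.ofReal_sub, Complex.norm_real, Real.norm_of_nonneg (by linarith),
    hre]
  -- Domination has made the difference nonnegative, so an upper bound for the power `‖f z‖ ^ k` is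
  -- enough.
  exact (sub_le_sub_right (pow_le_exp_neg_mul_one_sub (norm_nonneg _) k) _).trans
    exp_neg_sub_exp_neg_le

/-- The characteristic function `z ↦ e^{-Re φ(z)}` is rapidly decreasing under condition (B). -/
theorem ConditionB.integrable_abs_pow_mul {β : ℝ} {M P : Measure ℝ} [IsProbabilityMeasure P]
    (hB : ConditionB β M) (hnorm : ∀ z, ‖charFun P z‖ = Real.exp (-(phi M z).re)) (m : ℕ) :
    Integrable fun z : ℝ => |z| ^ m * ‖charFun P z‖ := by
  obtain ⟨α, c, R, hα, -, hc, h⟩ := hB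
  obtain ⟨K, hK, hle⟩ := exists_le_mul_exp_neg (f := fun z => ‖charFun P z‖)
    (fun z => norm_charFun_le_one z) (R := R) hc hα fun z hz => by
      simp only [hnorm]
      refine Real.exp_le_exp.mpr ?_
      have := h z hz
      rw [psi_re] at this
      linarith
  refine ((integrable_abs_pow_mul_exp_neg hc hα m).const_mul K).mono' ?_ (ae_of_all _ fun z => ?_)
  · have hcP : Continuous (charFun P) := continuous_charFun
    exact (by fun_prop : Continuous fun z : ℝ => |z| ^ m * ‖charFun P z‖).aestronglyMeasurable
  · rw [Real.norm_of_nonneg (by positivity)]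
    calc |z| ^ m * ‖charFun P z‖ ≤ |z| ^ m * (K * Real.exp (-c * |z| ^ α)) :=
          mul_le_mul_of_nonneg_left (hle z) (by positivity)
      _ = _ := by ring

/-- Condition (F) provides an integrable bound for `(1 + z²) e^{-Re φ_n(z)}`, uniform in `n`. -/
theorem ConditionF.exists_bound {δ : ℝ} {M P : Measure ℝ} [IsProbabilityMeasure P]
    {G : ℕ → Measure ℝ} {a : ℕ → ℕ} {b : ℕ → ℝ} (hF : ConditionF δ M G a b)
    (hF' : ∀ n, 1 ≤ n → IsProbabilityMeasure (scaledLaw G b n))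
    (hM : Integrable (fun u : ℝ => (1 + u ^ 2)⁻¹) M)
    (hnorm : ∀ z, ‖charFun P z‖ = Real.exp (-(phi M z).re))
    (hint : ∀ m : ℕ, Integrable fun z : ℝ => |z| ^ m * ‖charFun P z‖) :
    ∃ H : ℝ → ℝ, (∀ z, 0 ≤ H z) ∧ Integrable (fun z => (1 + z ^ 2) * H z) ∧
      ∀ n, 1 ≤ n → ∀ z, |z| ≤ δ * b n →
        Real.exp (-(phi (rowMeasure G a b n) z).re) ≤ H z := by
  obtain ⟨c, κ, hc, hκ, -, h⟩ := hF
  -- The sum of the majorants of the two alternatives serves every `n`, whichever alternative holds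
  -- for it.
  refine ⟨fun z => Real.exp (-c * |z| ^ κ) + ‖charFun P z‖, fun z => by positivity, ?_, ?_⟩
  · have h1 := (integrable_abs_pow_mul_exp_neg hc hκ 0).add (integrable_abs_pow_mul_exp_neg hc hκ 2)
    refine (h1.add ((hint 0).add (hint 2))).congr (ae_of_all _ fun z => ?_)
    simp only [Pi.add_apply, sq_abs]
    ring
  · intro n hn z hz
    have := hF' n hn
    rcases h n hn with h | h
    · refine le_add_of_le_of_nonneg (Real.exp_le_exp.mpr ?_) (norm_nonneg _)
      have := h z hz
      rw [integral_symmetrization _ (by fun_prop)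
        (fun u => by linarith [Real.cos_le_one (z * u)]) (fun u => by simp),
        ← phi_rowMeasure_re] at this
      linarith
    · refine le_add_of_nonneg_of_le (Real.exp_pos _).le ?_
      rw [hnorm]
      refine Real.exp_le_exp.mpr (neg_le_neg ?_)
      exact phi_re_le_of_symmetrization_le hM integrable_weight_rowMeasure h z

/-- A bound on `∫ |f - g|` from bounds inside and outside of an interval. -/
theorem integral_norm_sub_le {f g : ℝ → ℂ} (hf : Integrable f) (hg : Integrable g) {w : ℝ → ℝ}
    (hw0 : ∀ z, 0 ≤ w z) (hw : Integrable w) {T : ℝ} (h : ∀ z, |z| ≤ T → ‖f z - g z‖ ≤ w z) :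
    ∫ z, ‖f z - g z‖ ≤ (∫ z, w z) +
      ((∫ z in {z : ℝ | |z| ≤ T}ᶜ, ‖f z‖) + ∫ z in {z : ℝ | |z| ≤ T}ᶜ, ‖g z‖) := by
  have hs : MeasurableSet {z : ℝ | |z| ≤ T} := measurableSet_le (by fun_prop) measurable_const
  have hi : Integrable fun z => ‖f z - g z‖ := (hf.sub hg).norm
  rw [← integral_add_compl hs hi, ← integral_add hf.norm.integrableOn hg.norm.integrableOn]
  refine add_le_add ?_ ?_
  · exact (setIntegral_mono_on hi.integrableOn hw.integrableOn hs h).trans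
      (setIntegral_le_integral hw (ae_of_all _ hw0))
  · exact setIntegral_mono_on hi.integrableOn (hf.norm.add hg.norm).integrableOn hs.compl
      fun z _ => norm_sub_le _ _

end LocalLimit

/-! ### The local limit theorem. -/

theorem mainTheorem3
    -- the rows of the triangular array
    {Ω : ℕ → Type*} [∀ n, MeasurableSpace (Ω n)]
    (μ : ∀ n, Measure (Ω n)) [∀ n, IsProbabilityMeasure (μ n)]
    (a : ℕ → ℕ) (b : ℕ → ℝ) (ξ : ∀ n, Fin (a n) → Ω n → ℝ)
    (G : ℕ → Measure ℝ) (g : ℕ → ℝ → ℝ)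
    (ha : ∀ n, 1 ≤ n → 1 ≤ a n) (hb : ∀ n, 1 ≤ n → 0 < b n)
    (hindep : ∀ n, 1 ≤ n → iIndepFun (ξ n) (μ n))
    (hlaw : ∀ n, 1 ≤ n → ∀ k, HasLaw (ξ n k) (G n) (μ n))
    -- the limit: the law `P` with characteristic function `Φ = exp (-ψ)`
    (β : ℝ) (M : Measure ℝ) (hM : LocalLimit.IsCanonical M)
    (P : Measure ℝ) [IsProbabilityMeasure P]
    (hP : ∀ z : ℝ, charFun P z = LocalLimit.limitCharFun β M z)
    -- the conditions for the convergence of the row sums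
    (ha_top : Tendsto a atTop atTop)
    (hsmall : LocalLimit.UniformlySmall G b)
    (hconvM : LocalLimit.ConvergesProperly (LocalLimit.rowMeasure G a b) M)
    (hconvβ : Tendsto (fun n => (a n : ℝ) * LocalLimit.rowDrift G b n) atTop (𝓝 β))
    -- the conditions of the local limit theorem
    (δ : ℝ) (hδ : 0 < δ)
    (hA : LocalLimit.ConditionA G g)
    (hB : LocalLimit.ConditionB β M)
    (hC : LocalLimit.ConditionC G)
    (hD : LocalLimit.ConditionD g)
    (hE : LocalLimit.ConditionE a b)
    (hF : LocalLimit.ConditionF δ M G a b)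
    (hHa : LocalLimit.ConditionH (fun n => (a n : ℝ)))
    (hHb : LocalLimit.ConditionH b)
    -- symmetry, and `Φ_n ≥ Φ` on `|z| ≤ δ b_n` (both functions are real by symmetry)
    (hsymm_n : ∀ n, 1 ≤ n →
      LocalLimit.IsSymmetricLaw ((μ n).map (LocalLimit.rowSum a b ξ n)))
    (hsymm : LocalLimit.IsSymmetricLaw P)
    (hdom : ∀ n, 1 ≤ n → ∀ z : ℝ, |z| ≤ δ * b n →
      (LocalLimit.limitCharFun β M z).re ≤
        (charFun ((μ n).map (LocalLimit.rowSum a b ξ n)) z).re) :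
    ∃ (p : ℝ → ℝ) (pn : ℕ → ℝ → ℝ),
      (LocalLimit.IsDensity p P ∧ Continuous p) ∧
      (∀ n, 1 ≤ n →
        LocalLimit.IsDensity (pn n) ((μ n).map (LocalLimit.rowSum a b ξ n))) ∧
      (∀ n, 1 ≤ n → 2 ≤ a n → Continuous (pn n)) ∧
      ∃ (C : ℝ) (r : ℕ → ℝ), 0 < C ∧
        (∀ k : ℕ, r =o[atTop] (fun n : ℕ => ((n : ℝ) ^ k)⁻¹)) ∧
        ∀ n, 1 ≤ n → 2 ≤ a n → ∀ x : ℝ,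
          |pn n x - p x| ≤ C * (LocalLimit.gammaRe M G a b n + r n) := by
  open LocalLimit in
  have hGp : ∀ n, 1 ≤ n → IsProbabilityMeasure (G n) := fun n hn =>
    (hlaw n hn ⟨0, ha n hn⟩).isProbabilityMeasure_iff.mp inferInstance
  have hFp : ∀ n, 1 ≤ n → IsProbabilityMeasure (scaledLaw G b n) := fun n hn => by
    have := hGp n hn
    exact Measure.isProbabilityMeasure_map (by fun_prop)
  have hchar : ∀ n, 1 ≤ n → ∀ z,
      charFun ((μ n).map (rowSum a b ξ n)) z = charFun (G n) (z / b n) ^ a n :=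
    fun n hn z => charFun_map_sum_div (hindep n hn) (hlaw n hn) (b n) z
  have hscaled : ∀ n z, charFun (scaledLaw G b n) z = charFun (G n) (z / b n) :=
    fun n z => charFun_map_div (G n) (b n) z
  have hMw := hM.integrable_weight
  have hPexp := charFun_eq_exp_neg_phi_re hP hsymm
  have hPnorm : ∀ z, ‖charFun P z‖ = Real.exp (-(phi M z).re) := fun z => by
    rw [hP, norm_limitCharFun]
  have hPm := hB.integrable_abs_pow_mul hPnorm
  have hPi : Integrable (charFun P) := by
    rw [← integrable_norm_iff (by fun_prop)]
    simpa using hPm 0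
  obtain ⟨H, hH0, hHi, hH⟩ := hF.exists_bound hFp hMw hPnorm hPm
  obtain ⟨N, hN0, hN1, hN⟩ := hC.exists_lt_one hGp hδ
  obtain ⟨L, hL0, hL⟩ : ∃ L : ℝ, 0 ≤ L ∧ ∀ n, 1 ≤ n →
      Integrable (fun z => ‖charFun (G n) z‖ ^ 2) ∧ ∫ z, ‖charFun (G n) z‖ ^ 2 ≤ L := by
    refine ⟨(ENNReal.ofReal (2 * Real.pi) * ⨆ n ∈ Set.Ici (1 : ℕ),
      ∫⁻ x, ENNReal.ofReal (g n x ^ 2)).toReal, ENNReal.toReal_nonneg, fun n hn => ?_⟩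
    have := hGp n hn
    exact integrable_charFun_sq (hA n hn) hD (le_iSup₂_of_le n (Set.mem_Ici.mpr hn) le_rfl)
  have hSi : ∀ n, 1 ≤ n → 2 ≤ a n → Integrable (charFun ((μ n).map (rowSum a b ξ n))) := by
    intro n hn han
    have := hGp n hn
    rw [funext (hchar n hn)]
    exact integrable_charFun_div_pow (hL n hn).1 (hb n hn) han
  have hSfin : ∀ n, IsFiniteMeasure ((μ n).map (rowSum a b ξ n)) := fun n => inferInstance
  -- For `a n = 1` square integrability of the characteristic function does not give integrability,
  -- so the rescaled density `g n` replaces the inversion formula.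
  refine ⟨invDensity P, fun n => if 2 ≤ a n then invDensity ((μ n).map (rowSum a b ξ n))
    else fun x => b n * g n (b n * x), ⟨isDensity_invDensity hPi, continuous_invDensity hPi⟩,
    fun n hn => ?_, fun n hn han => ?_, ?_⟩
  · by_cases han : 2 ≤ a n
    · simp only [han, if_true]
      exact isDensity_invDensity (hSi n hn han)
    · simp only [han, if_false]
      have h1 : a n = 1 := by have := ha n hn; omega
      have hlawS : (μ n).map (rowSum a b ξ n) = scaledLaw G b n := by
        have := hFp n hn
        refine Measure.ext_of_charFun (funext fun z => ?_)
        rw [hchar n hn, hscaled, h1, pow_one]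
      rw [hlawS]
      exact (hA n hn).map_div (hb n hn)
  · simp only [han, if_true]
    exact continuous_invDensity (hSi n hn han)
  set K := ∫ z, (1 + z ^ 2) * H z with hK
  have hK0 : 0 ≤ K := integral_nonneg fun z => mul_nonneg (by positivity) (hH0 z)
  set r₁ : ℕ → ℝ := fun n => ∫ z in {z : ℝ | |z| ≤ δ * b n}ᶜ, ‖charFun P z‖ with hr₁
  set r₂ : ℕ → ℝ := fun n => N ^ (a n - 2) * (b n * L) with hr₂
  have hr₁0 : ∀ n, 0 ≤ r₁ n := fun n => integral_nonneg fun z => norm_nonneg _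
  have hr₂0 : ∀ n, 1 ≤ n → 0 ≤ r₂ n := fun n hn => by
    have := hb n hn
    positivity
  -- The estimate obtained is `K * gammaRe + r₁ + r₂`; the constant `K + 1` dominates both
  -- coefficients and is positive even if `K = 0`.
  refine ⟨K + 1, fun n => r₁ n + r₂ n, by positivity, fun k => ?_, fun n hn han x => ?_⟩
  · refine IsLittleO.add ?_ ?_
    · obtain ⟨s, ε, hs, hε, hlow⟩ := hHb.exists_lower
      refine isLittleO_inv_pow_of_forall_pow_mul_le (y := fun _ => 1) (t := 0) (K := 1) hs hε hlow
        (by simp) (fun m => ?_) k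
      refine ⟨(δ ^ m)⁻¹ * ∫ z : ℝ, |z| ^ m * ‖charFun P z‖,
        mul_nonneg (by positivity) (integral_nonneg fun z => by positivity), ?_⟩
      filter_upwards [eventually_ge_atTop 1] with n hn
      rw [abs_of_nonneg (hr₁0 n)]
      refine (setIntegral_tail_le (fun z => norm_nonneg _) hPi.norm (hPm m)
        (mul_pos hδ (hb n hn))).trans (le_of_eq ?_)
      rw [mul_pow, mul_inv]
      ring
    · obtain ⟨s, ε, hs, hε, hlow⟩ := hHa.exists_lower
      obtain ⟨t, B, -, hup⟩ := hHb.exists_upper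
      refine isLittleO_inv_pow_of_forall_pow_mul_le hs hε hlow hup (fun m => ?_) k
      obtain ⟨Q, hQ0, hQ⟩ := exists_pow_mul_pow_sub_two_le hN0 hN1 m
      refine ⟨Q * L, by positivity, ?_⟩
      filter_upwards [eventually_ge_atTop 1, ha_top.eventually_ge_atTop 2] with n hn han
      rw [abs_of_nonneg (hr₂0 n hn)]
      have := hb n hn
      calc r₂ n ≤ Q * ((a n : ℝ) ^ m)⁻¹ * (b n * L) :=
            mul_le_mul_of_nonneg_right (hQ (a n) han) (by positivity)
        _ = _ := by ring
  · have hGn := hGp n hn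
    have hFn := hFp n hn
    simp only [han, if_true]
    have hγ := gammaRe_nonneg M G a b n
    have hbound : ∀ z, |z| ≤ δ * b n →
        ‖charFun ((μ n).map (rowSum a b ξ n)) z - charFun P z‖ ≤
          gammaRe M G a b n * ((1 + z ^ 2) * H z) := by
      intro z hz
      have hkey := norm_pow_sub_exp_neg_le (f := charFun (scaledLaw G b n)) continuous_charFun
        (by simp) (k := a n) (by omega) (h := fun z => (phi M z).re) (T := δ * b n)
        (fun z => by rw [hscaled, ← hchar n hn]; exact (hsymm_n n hn).charFun_im z)
        (fun z hz => by
          have := hdom n hn z hz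
          rwa [← hP, hPexp, Complex.ofReal_re, hchar n hn, ← hscaled] at this) hz
      -- Here `a_n (1 - Re θ_n(z / b_n))` becomes `Re φ_n(z)`, exactly and not only asymptotically.
      rw [← integral_one_sub_cos, ← phi_rowMeasure_re] at hkey
      rw [hchar n hn, ← hscaled, hPexp]
      calc _ ≤ _ := hkey
        _ ≤ gammaRe M G a b n * (1 + z ^ 2) * H z :=
          mul_le_mul (abs_phi_re_sub_le hMw integrable_weight_rowMeasure z) (hH n hn z hz)
            (Real.exp_pos _).le (by positivity)
        _ = _ := by ring
    have htail : ∫ z in {z : ℝ | |z| ≤ δ * b n}ᶜ, ‖charFun ((μ n).map (rowSum a b ξ n)) z‖ ≤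
        r₂ n := by
      rw [funext (hchar n hn)]
      refine (setIntegral_charFun_div_pow_le (hL n hn).1 (hb n hn) hN0.le (hN n hn) han).trans ?_
      have := hb n hn
      have := (hL n hn).2
      simp only [hr₂]
      gcongr
    have hmain := integral_norm_sub_le (hSi n hn han) hPi
      (fun z => mul_nonneg hγ (mul_nonneg (by positivity) (hH0 z))) (hHi.const_mul _) hbound
    rw [integral_const_mul] at hmain
    have h1 := abs_invDensity_sub_le (hSi n hn han) hPi x
    have h2 := hr₁0 n
    have h3 := hr₂0 n hn
    nlinarith [mul_nonneg hK0 h2, mul_nonneg hK0 h3]
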